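/- **Model.** Let $\Theta\subset\mathbb R^d$, $\mathcal X=\{1,\dots,S\}$, and let $\mu$ be a $\sigma$-finite measure on a measurable space $\mathcal Y$. For $\theta\in\Theta$ let $Q_\theta=(q_\theta(a,b))$ be a transition matrix on $\mathcal X$ with stationary distribution $r_\theta$, and let $g_\theta(\cdot\mid a)$ be probability densities with respect to $\mu$ (all measurable in $(\theta,y)$). Put $p_\theta(y_1^n)=\sum_{x\in\mathcal X^n} r_\theta(x_1)\prod_{t<n}q_\theta(x_t,x_{t+1})\prod_{t\le n}g_\theta(y_t\mid x_t)$. Let $\theta_0\in\Theta$ and let $Y_1,Y_2,\dots$ be a sequence such that, under $P_0$, $(Y_1,\dots,Y_n)$ has density $p_{\theta_0}$ with respect to $\mu^n$ for every $n$. Write $Y_{[j]}=(Y_{(j-1)m+1},\dots,Y_{jm})$ for the $j$th block of length $m$, $L_{jm}(\theta)=\log p_\theta(Y_{[j]})$, and $B_{\delta}(\theta_0)=\{\theta\in\Theta:\|\theta-\theta_0\|\le\delta\}$. The one-block conditional likelihood is $p_\theta(Y_{[j]}\mid Y_{[j-1]})=\sum_a p_\theta(Y_{[j]}\mid X_{(j-1)m+1}=a)\,p_\theta(X_{(j-1)m+1}=a\mid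 Y_{[j-1]})$, where the filter $p_\theta(X_{(j-1)m+1}=\cdot\mid Y_{[j-1]})$ is computed from the block $Y_{[j-1]}$ alone, started from $r_\theta$. **Assumptions.** (A1) There is $\delta_0>0$ such that for all $m\ge1$ and $z\in\mathcal Y^m$ the function $\theta\mapsto\log p_\theta(z)$ is finite and three times differentiable in $B_{\delta_0}(\theta_0)$, with all partial derivatives of orders 1, 2, 3 bounded there in absolute value by an envelope $M_m(z)$, and $M_m(Y_1^m)/m\to C_M$ $P_0$-a.s. for a constant $C_M>0$. (A2) There is a continuous $L:\Theta\to\mathbb R$ with unique global maximum at $\theta_0$ such that for every fixed $j\ge 1$, $m^{-1}L_{jm}\to L$ $P_0$-a.s., uniformly on compact subsets of $\Theta$. (A3) For every fixed $j\ge1$, $m^{-1/2}L_{jm}'(\theta_0)$ converges weakly to $N_d(0,I_0)$, where $I_0$ (the Fisher information matrix) is positive definite. (A4) For every fixed $j\ge1$ and every random sequence $\theta^*_m\in\Theta$ with $\theta^*_m\to\theta_0$ $P_0$-a.s., $-m^{-1}L_{jm}''(\theta^*_m)\to I_0$ in $P_0$-probability. Moreover there are constants $0<c_1\le c_2$ such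 that for all sufficiently large $m$, all $z\in\mathcal Y^m$ and all $\theta\in B_{\delta_0}(\theta_0)$ the eigenvalues of $-m^{-1}\,\partial_\theta^2\log p_\theta(z)$ lie in $[c_1,c_2]$. (A5) $\Theta$ is compact and $\theta_0$ is an interior point of $\Theta$. (A6) The prior has a density $\pi$ with respect to Lebesgue measure on $\Theta$ that is positive and continuous on $\Theta$. (A7) For every $\theta\in\Theta$ the matrix $Q_\theta$ is ergodic (some power has all entries positive). (A8) Let $\epsilon=\inf_{\theta\in\Theta,a,b}q_\theta(a,b)$ and $h_\theta(y)=\max_{a,b}g_\theta(y\mid a)/g_\theta(y\mid b)$. Then $\epsilon>0$ and: (i) $\max_a\int\max_b|\log g_\theta(y\mid b)|\,g_{\theta_0}(y\mid a)\,\mu(dy)<\infty$ for all $\theta\in\Theta$; (ii) there is a constant $M\ge1$ with $\sup_{\theta\in\Theta}h_\theta(Y_1)<M$ $P_0$-a.s.; (iii) with $\mu_\theta(y)=\{1+(S-1)\epsilon^{-2}h_\theta(y)\}^{-1}$ and $\rho=\exp\{-2/(1+(S-1)\epsilon^{-2}M)\}$, for every $\theta\in\Theta$, $P_0$-a.s.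 for all $m\ge2$, $$\|p_\theta(X_{m+1}=\cdot\mid Y_1^m)-r_\theta\|_{TV}\le S\prod_{i=2}^{m-1}e^{-2\mu_\theta(Y_i)}\le S\rho^{m-2}.$$ **Theorem.** Let $K_m\to\infty$ be integers and $n=mK_m$. Let $\hat\theta_j=\hat\theta_m(Y_{[j]})$ be the maximum likelihood estimator of $\theta$ on block $j$: a measurable function of the block which, for each fixed $j$, with $P_0$-probability tending to one as $m\to\infty$, maximizes $L_{jm}$ over $\Theta$ and solves $L_{jm}'(\theta)=0$. Let the $j$th subset posterior be the distribution on $\Theta$ with density proportional to $p_\theta(Y_{[1]})^{K_m}\pi(\theta)$ if $j=1$, and to $p_\theta(Y_{[j]}\mid Y_{[j-1]})^{K_m}\pi(\theta)$ if $j\ge2$, and let $\Pi_m^{h_j}$ be the distribution of $h_j=\sqrt n(\theta-\hat\theta_j)$ under it. Assume (A1)–(A7). Then: (i) $\|\Pi_m^{h_1}-N_d(0,I_0^{-1})\|_{TV}\to0$ in $P_0$-probability as $m\to\infty$. (ii) If (A8) also holds and $K_m=o(\rho^{-m})$, then $\|\Pi_m^{h_{j}}-N_d(0,I_0^{-1})\|_{TV}\to0$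 in $P_0$-probability as $m\to\infty$ for $j=2,\dots,K_m$, that is, for every choice of indices $j=j_m$ with $2\le j_m\le K_m$ (in particular for every fixed $j\ge2$). -/

import Mathlib

open MeasureTheory ProbabilityTheory Filter Topology

noncomputable section

/-- `ℝ^d` with the Euclidean norm. -/
abbrev Par (d : ℕ) : Type := EuclideanSpace ℝ (Fin d)

/-- A parametric family of stationary hidden Markov models with latent states `Fin S`, observations
in `𝒴`, and parameters `θ ∈ Θ ⊆ ℝ^d`: a stationary initial distribution `r_θ`, a transition matrix
`Q_θ`, and emission densities `g_θ(· | a)` with respect to `μ`. Only the values at `θ ∈ Θ` carry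
meaning. -/
structure HMMFamily {d : ℕ} (S : ℕ) {𝒴 : Type*} [MeasurableSpace 𝒴] (μ : Measure 𝒴)
    (Θ : Set (Par d)) where
  /-- `init θ a = r_θ(a)` -/
  init : Par d → Fin S → ℝ
  /-- `trans θ a b = q_θ(a, b)` -/
  trans : Par d → Matrix (Fin S) (Fin S) ℝ
  /-- `emis θ y a = g_θ(y | a)` -/
  emis : Par d → 𝒴 → Fin S → ℝ
  init_nonneg : ∀ θ ∈ Θ, ∀ a, 0 ≤ init θ a
  init_sum : ∀ θ ∈ Θ, ∑ a, init θ a = 1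
  trans_nonneg : ∀ θ ∈ Θ, ∀ a b, 0 ≤ trans θ a b
  trans_sum : ∀ θ ∈ Θ, ∀ a, ∑ b, trans θ a b = 1
  stationary : ∀ θ ∈ Θ, ∀ b, ∑ a, init θ a * trans θ a b = init θ b
  emis_nonneg : ∀ θ ∈ Θ, ∀ y a, 0 ≤ emis θ y a
  emis_lintegral : ∀ θ ∈ Θ, ∀ a, ∫⁻ y, ENNReal.ofReal (emis θ y a) ∂μ = 1
  measurable_init : ∀ a, Measurable fun θ => init θ a
  measurable_trans : ∀ a b, Measurable fun θ => trans θ a b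
  measurable_emis : ∀ a, Measurable fun p : Par d × 𝒴 => emis p.1 p.2 a

namespace HMMFamily

variable {d S : ℕ} {𝒴 : Type*} [MeasurableSpace 𝒴] {μ : Measure 𝒴} {Θ : Set (Par d)}
  (H : HMMFamily S μ Θ)

/-- `ν(x_1) ∏_{t=1}^{n-1} q_θ(x_t, x_{t+1})`: the probability of the state path `x_1, …, x_n` when
`x_1` has distribution `ν`. -/
def pathProb (θ : Par d) (ν : Fin S → ℝ) {n : ℕ} (x : Fin n → Fin S) : ℝ :=
  ∏ t : Fin n, if t.val = 0 then ν (x t)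
    else H.trans θ (x ⟨t.val - 1, by have := t.isLt; omega⟩) (x t)

/-- The density of `n` consecutive observations when the first of their states has
distribution `ν`: `∑_x ν(x_1) ∏ q_θ(x_t, x_{t+1}) ∏ g_θ(y_t | x_t)`. -/
def likFrom (θ : Par d) (ν : Fin S → ℝ) {n : ℕ} (y : Fin n → 𝒴) : ℝ :=
  ∑ x : Fin n → Fin S, H.pathProb θ ν x * ∏ t, H.emis θ (y t) (x t)

/-- The marginal density `p_θ(y_1, …, y_n)`. -/
def lik (θ : Par d) {n : ℕ} (y : Fin n → 𝒴) : ℝ := H.likFrom θ (H.init θ) y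

/-- The log-likelihood `θ ↦ log p_θ(y_1, …, y_n)`. -/
def logLik {n : ℕ} (y : Fin n → 𝒴) (θ : Par d) : ℝ := Real.log (H.lik θ y)

/-- The prediction filter `p_θ(X_{n+1} = a | Y_1^n = y)`. -/
def predFilter (θ : Par d) {n : ℕ} (y : Fin n → 𝒴) (a : Fin S) : ℝ :=
  (∑ x : Fin (n + 1) → Fin S, if x (Fin.last n) = a then
      H.pathProb θ (H.init θ) x * ∏ t : Fin n, H.emis θ (y t) (x t.castSucc) else 0) / H.lik θ y

/-- The conditional density `p_θ(y | y')` of a block `y` given the block `y'` immediately before it: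
`∑_a p_θ(y | X_first = a) p_θ(X_first = a | y')`. -/
def condLik (θ : Par d) {n n' : ℕ} (y : Fin n → 𝒴) (y' : Fin n' → 𝒴) : ℝ :=
  ∑ a, H.likFrom θ (Pi.single a 1) y * H.predFilter θ y' a

/-- `Y_1, Y_2, …` are the observations of the hidden Markov model with parameter `θ`: for every `n`
the law of `(Y_1, …, Y_n)` has density `p_θ` with respect to `μ^n`. (`Y 0` plays no role.) -/
def IsObservation [SigmaFinite μ] {Ω : Type*} [MeasurableSpace Ω] (θ : Par d) (P : Measure Ω)
    (Y : ℕ → Ω → 𝒴) : Prop :=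
  (∀ t, Measurable (Y t)) ∧
  ∀ n : ℕ, P.map (fun ω (i : Fin n) => Y (i + 1) ω) =
    (Measure.pi fun _ : Fin n => μ).withDensity fun y => ENNReal.ofReal (H.lik θ y)

/-- `θ` is a maximum likelihood estimate on the block `y`, and solves the likelihood equation. -/
def IsMLE {n : ℕ} (y : Fin n → 𝒴) (θ : Par d) : Prop :=
  θ ∈ Θ ∧ (∀ θ' ∈ Θ, H.lik θ' y ≤ H.lik θ y) ∧ HasGradientAt (H.logLik y) 0 θ

end HMMFamily

/-- The `j`th block `(Y_{(j-1)m+1}, …, Y_{jm})` of length `m`, for `j ≥ 1`. -/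
def block {Ω 𝒴 : Type*} (Y : ℕ → Ω → 𝒴) (m j : ℕ) (ω : Ω) : Fin m → 𝒴 :=
  fun i => Y ((j - 1) * m + i + 1) ω

/-- Total variation distance between (finite) measures. -/
def tvDist {E : Type*} [MeasurableSpace E] (ν₁ ν₂ : Measure E) : ℝ :=
  ⨆ A : {A : Set E // MeasurableSet A}, |ν₁.real A - ν₂.real A|

/-- Total variation distance between two probability vectors. -/
def tvVec {S : ℕ} (p q : Fin S → ℝ) : ℝ := (∑ a, |p a - q a|) / 2

/-- The measure on `Θ` with Lebesgue density `θ ↦ ℓ(θ) ϖ(θ)`, before normalization. -/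
def unnormPosterior {d : ℕ} (Θ : Set (Par d)) (ϖ ℓ : Par d → ℝ) : Measure (Par d) :=
  (volume.restrict Θ).withDensity fun θ => ENNReal.ofReal (ℓ θ * ϖ θ)

/-- The (quasi-)posterior distribution on `Θ` with (quasi-)likelihood `ℓ` and prior density `ϖ`. -/
def posterior {d : ℕ} (Θ : Set (Par d)) (ϖ ℓ : Par d → ℝ) : Measure (Par d) :=
  (unnormPosterior Θ ϖ ℓ Set.univ)⁻¹ • unnormPosterior Θ ϖ ℓ

/-- The distribution of the local parameter `√n (θ - c)` when `θ` has distribution `ν`. -/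
def localLaw {d : ℕ} (n : ℕ) (c : Par d) (ν : Measure (Par d)) : Measure (Par d) :=
  ν.map fun θ => Real.sqrt n • (θ - c)

section Assumptions

variable {d S : ℕ} {𝒴 : Type*} [MeasurableSpace 𝒴] {μ : Measure 𝒴} {Θ : Set (Par d)}
  (H : HMMFamily S μ Θ) (θ₀ : Par d) {Ω : Type*} [MeasurableSpace Ω] (P : Measure Ω)
  (Y : ℕ → Ω → 𝒴)

/-- The neighbourhood `B_δ(θ₀) = {θ ∈ Θ : ‖θ - θ₀‖ ≤ δ}`. -/
def nbhd (Θ : Set (Par d)) (θ₀ : Par d) (δ : ℝ) : Set (Par d) := {θ ∈ Θ | ‖θ - θ₀‖ ≤ δ}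

/-- Partial derivative `∂^k f / ∂θ_{l_1} ⋯ ∂θ_{l_k}`. -/
def partialDeriv (k : ℕ) (l : Fin k → Fin d) (f : Par d → ℝ) (θ : Par d) : ℝ :=
  iteratedFDeriv ℝ k f θ fun i => EuclideanSpace.single (l i) 1

/-- Existence of an envelope function: on `B_δ(θ₀)` every log-likelihood is (finite and) three times
differentiable, and its partial derivatives of orders one to three are bounded by an envelope `M`
with `M(Y_1, …, Y_m) / m` almost surely convergent to a positive constant. Derivatives are taken at
the interior points of `B_δ(θ₀)`. -/
def EnvelopeCondition (δ : ℝ) : Prop :=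
  0 < δ ∧
  (∀ m : ℕ, 1 ≤ m → ∀ z : Fin m → 𝒴, ∀ θ ∈ interior (nbhd Θ θ₀ δ),
    0 < H.lik θ z ∧ ∀ k : ℕ, k < 3 → DifferentiableAt ℝ (iteratedFDeriv ℝ k (H.logLik z)) θ) ∧
  ∃ M : (m : ℕ) → (Fin m → 𝒴) → ℝ, (∀ m, Measurable (M m)) ∧
    (∀ m : ℕ, 1 ≤ m → ∀ z : Fin m → 𝒴, ∀ θ ∈ interior (nbhd Θ θ₀ δ),
      ∀ k ∈ Finset.Icc 1 3, ∀ l : Fin k → Fin d, |partialDeriv k l (H.logLik z) θ| ≤ M m z) ∧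
    ∃ C : ℝ, 0 < C ∧
      ∀ᵐ ω ∂P, Tendsto (fun m : ℕ => M m (block Y m 1 ω) / m) atTop (𝓝 C)

/-- Law of large numbers for the log-likelihood: for every block number `j`,
`m⁻¹ log p_θ(Y_{(j-1)m+1}^{jm}) → L(θ)` almost surely, uniformly on compact subsets of `Θ` (in
particular the left side is finite there for large `m`), where `L` is continuous with unique global
maximum at `θ₀`. -/
def LikelihoodLLN : Prop :=
  ∃ L : Par d → ℝ, ContinuousOn L Θ ∧ (∀ θ ∈ Θ, θ ≠ θ₀ → L θ < L θ₀) ∧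
    ∀ j : ℕ, 1 ≤ j → ∀ C : Set (Par d), C ⊆ Θ → IsCompact C → ∀ᵐ ω ∂P,
      (∀ᶠ m : ℕ in atTop, ∀ θ ∈ C, 0 < H.lik θ (block Y m j ω)) ∧
      TendstoUniformlyOn (fun (m : ℕ) θ => H.logLik (block Y m j ω) θ / m) L atTop C

/-- Central limit theorem for the score at `θ₀` on every block, with limit covariance `I₀`. -/
def ScoreCLT [IsProbabilityMeasure P] (I₀ : Matrix (Fin d) (Fin d) ℝ) : Prop :=
  ∀ j : ℕ, 1 ≤ j →
    TendstoInDistribution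
      (fun (m : ℕ) ω => (Real.sqrt m)⁻¹ • gradient (H.logLik (block Y m j ω)) θ₀)
      atTop (id : Par d → Par d) (fun _ => P) (multivariateGaussian 0 I₀)

/-- Law of large numbers for the observed information: `-m⁻¹ L''(θ*_m) → I₀` in probability on every
block along every random sequence `θ*_m → θ₀`. Furthermore, for large `m` the eigenvalues of
`-m⁻¹ L''(θ)` lie between two positive constants, for all `θ ∈ B_δ(θ₀)` and all data. -/
def ObservedInfoLLN (δ : ℝ) (I₀ : Matrix (Fin d) (Fin d) ℝ) : Prop :=
  (∀ j : ℕ, 1 ≤ j → ∀ θs : ℕ → Ω → Par d, (∀ m, Measurable (θs m)) → (∀ m ω, θs m ω ∈ Θ) →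
    (∀ᵐ ω ∂P, Tendsto (fun m => θs m ω) atTop (𝓝 θ₀)) → ∀ k l : Fin d,
      TendstoInMeasure P
        (fun (m : ℕ) ω => -(partialDeriv 2 ![k, l] (H.logLik (block Y m j ω)) (θs m ω)) / m)
        atTop fun _ => I₀ k l) ∧
  ∃ c₁ c₂ : ℝ, 0 < c₁ ∧ ∃ m₀ : ℕ, ∀ m : ℕ, m₀ ≤ m → 1 ≤ m → ∀ y : Fin m → 𝒴,
    ∀ θ ∈ interior (nbhd Θ θ₀ δ), ∀ v : Par d,
      c₁ * ‖v‖ ^ 2 ≤ -(iteratedFDeriv ℝ 2 (H.logLik y) θ fun _ => v) / m ∧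
      -(iteratedFDeriv ℝ 2 (H.logLik y) θ fun _ => v) / m ≤ c₂ * ‖v‖ ^ 2

/-- The prior density: a probability density on `Θ`, positive and continuous on `Θ`. -/
def PriorCondition (Θ : Set (Par d)) (ϖ : Par d → ℝ) : Prop :=
  (∀ θ ∈ Θ, 0 < ϖ θ) ∧ ContinuousOn ϖ Θ ∧ ∫⁻ θ in Θ, ENNReal.ofReal (ϖ θ) = 1

/-- `ε = inf_{θ ∈ Θ, a, b} q_θ(a, b)`. -/
def minTrans : ℝ := sInf {x | ∃ θ ∈ Θ, ∃ a b : Fin S, x = H.trans θ a b}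

/-- `h_θ(y) = max_{a, b} g_θ(y | a) / g_θ(y | b)`. -/
def emisRatio (θ : Par d) (y : 𝒴) : ℝ := ⨆ p : Fin S × Fin S, H.emis θ y p.1 / H.emis θ y p.2

/-- `μ_θ(y) = (1 + (S - 1) ε⁻² h_θ(y))⁻¹`. -/
def mixRate (θ : Par d) (y : 𝒴) : ℝ :=
  (1 + ((S : ℝ) - 1) * (minTrans H ^ 2)⁻¹ * emisRatio H θ y)⁻¹

/-- The mixing coefficient `ρ = exp(-2 / (1 + (S - 1) ε⁻² M))`. -/
def mixCoef (M : ℝ) : ℝ := Real.exp (-2 / (1 + ((S : ℝ) - 1) * (minTrans H ^ 2)⁻¹ * M))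

/-- Global mixing conditions: integrability of the log emission densities, a uniform almost sure
bound `sup_θ h_θ(Y_1) < M` (in particular the emission densities are positive at `Y_1`), and
geometric convergence of the prediction filter to the stationary distribution. -/
structure FilterMixing (M : ℝ) : Prop where
  one_le : 1 ≤ M
  integrable_log : ∀ θ ∈ Θ, ∀ a : Fin S,
    Integrable (fun y => (⨆ b : Fin S, |Real.log (H.emis θ y b)|) * H.emis θ₀ y a) μ
  ratio_lt : ∀ᵐ ω ∂P, (∀ θ ∈ Θ, ∀ a, 0 < H.emis θ (Y 1 ω) a) ∧
    ∃ c < M, ∀ θ ∈ Θ, emisRatio H θ (Y 1 ω) ≤ c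
  filter_conv : ∀ θ ∈ Θ, ∀ᵐ ω ∂P, ∀ m : ℕ, 2 ≤ m →
    tvVec (H.predFilter θ (block Y m 1 ω)) (H.init θ) ≤
        S * ∏ i ∈ Finset.Icc 2 (m - 1), Real.exp (-2 * mixRate H θ (Y i ω)) ∧
      S * ∏ i ∈ Finset.Icc 2 (m - 1), Real.exp (-2 * mixRate H θ (Y i ω)) ≤
        S * mixCoef H M ^ (m - 2)

/-- The quasi-likelihood of block `j`, the `K`th power of `p_θ(Y_1^m)` for `j = 1` and of the
one-block conditional likelihood `p_θ(Y_{(j-1)m+1}^{jm} | Y_{(j-2)m+1}^{(j-1)m})` for `j ≥ 2`. -/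
def quasiLik (m K j : ℕ) (ω : Ω) (θ : Par d) : ℝ :=
  if j = 1 then H.lik θ (block Y m 1 ω) ^ K
  else H.condLik θ (block Y m j ω) (block Y m (j - 1) ω) ^ K

/-- The distribution of `h_j = √(mK) (θ - c)` under the `j`th subset posterior. -/
def subsetLocalPosterior (ϖ : Par d → ℝ) (m K j : ℕ) (c : Par d) (ω : Ω) : Measure (Par d) :=
  localLaw (m * K) c (posterior Θ ϖ (quasiLik H Y m K j ω))

end Assumptions

end

/-! The argument is a Laplace approximation run path by path. After the change of variable `h = √n
(θ - c)` at the block maximizer `c`, both the posterior and the Gaussian limit are normalized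
densities, and total variation between these is at most a constant times the `L¹` distance of the
unnormalized densities, under any rescaling (`tvDist_normalizeMeasure_withDensity_le`). Dividing by
`ℓ(c)^K ϖ(θ₀)` leaves one `L¹` limit, obtained by dominated convergence
(`tendsto_lintegral_localDensity_sub`).

Pointwise convergence is a second order Taylor expansion at `c`, where the gradient vanishes: the
third derivative envelope lets the Hessian be replaced by the one at `θ₀`, which converges to `-I₀`
after division by `m` (`tendsto_mul_sub_local`). Domination is a quadratic upper bound valid on all
of `Θ`: curvature gives it near `θ₀`, and the uniform law of large numbers with compactness gives it
elsewhere (`mul_sub_le_of_curvature_of_separation`). Hypotheses that hold only in probability become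
almost sure along a common subsequence (`tendstoInMeasure_tvBound`).

For later blocks, geometric forgetting of the filter and `r_θ ≥ ε` make the conditional likelihood
equal to the block likelihood up to a relative error of order `ρ^m`; its `K`th power is still
asymptotically equivalent because `K ρ^m → 0`. This is proved for blocks 1 and 2. Stationarity moves
it to any pair `(j - 1, j)`, even with `j` depending on `m`, because only the law of the pair
matters for convergence in probability to a constant. -/

/-- The normalization of a measure to total mass one. -/
noncomputable def normalizeMeasure {E : Type*} [MeasurableSpace E] (κ : Measure E) : Measure E :=
  (κ Set.univ)⁻¹ • κ

/-! ### Normalized measures and total variation -/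

section Normalize

variable {E F : Type*} [MeasurableSpace E] [MeasurableSpace F]

lemma normalizeMeasure_smul (κ : Measure E) {c : ENNReal} (h0 : c ≠ 0) (ht : c ≠ ⊤) :
    normalizeMeasure (c • κ) = normalizeMeasure κ := by
  unfold normalizeMeasure
  rw [smul_smul, Measure.smul_apply, smul_eq_mul, ENNReal.mul_inv (Or.inl h0) (Or.inl ht),
    mul_comm (c⁻¹), mul_assoc, ENNReal.inv_mul_cancel h0 ht, mul_one]

lemma normalizeMeasure_map (κ : Measure E) {f : E → F} (hf : Measurable f) :
    (normalizeMeasure κ).map f = normalizeMeasure (κ.map f) := by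
  unfold normalizeMeasure
  rw [Measure.map_smul, Measure.map_apply hf MeasurableSet.univ, Set.preimage_univ]

lemma map_withDensity_comp (ν : Measure E) {f : E → F} (hf : Measurable f) {g : F → ENNReal}
    (hg : Measurable g) :
    (ν.withDensity fun x => g (f x)).map f = (ν.map f).withDensity g := by
  ext s hs
  rw [Measure.map_apply hf hs, withDensity_apply _ (hf hs), withDensity_apply _ hs,
    setLIntegral_map hs hg hf]

lemma normalizeMeasure_real_apply (κ : Measure E) (A : Set E) :
    (normalizeMeasure κ).real A = (κ.real Set.univ)⁻¹ * κ.real A := by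
  simp [normalizeMeasure, Measure.real, ENNReal.toReal_mul, ENNReal.toReal_inv]

lemma normalizeMeasure_real_mem (κ : Measure E) (A : Set E) :
    0 ≤ (normalizeMeasure κ).real A ∧ (normalizeMeasure κ).real A ≤ 1 := by
  refine ⟨measureReal_nonneg, ?_⟩
  have h : normalizeMeasure κ A ≤ 1 := by
    calc normalizeMeasure κ A ≤ normalizeMeasure κ Set.univ := measure_mono (Set.subset_univ _)
      _ = (κ Set.univ)⁻¹ * κ Set.univ := rfl
      _ ≤ 1 := ENNReal.inv_mul_le_one _
  exact ENNReal.toReal_le_of_le_ofReal zero_le_one (by simpa using h)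

lemma tvDist_normalizeMeasure_le_one (κ κ' : Measure E) :
    tvDist (normalizeMeasure κ) (normalizeMeasure κ') ≤ 1 := by
  have : Nonempty {A : Set E // MeasurableSet A} := ⟨⟨∅, MeasurableSet.empty⟩⟩
  refine ciSup_le fun A => ?_
  have h1 := normalizeMeasure_real_mem κ A
  have h2 := normalizeMeasure_real_mem κ' A
  rw [abs_le]; constructor <;> linarith [h1.1, h1.2, h2.1, h2.2]

lemma tvDist_nonneg (ν₁ ν₂ : Measure E) : 0 ≤ tvDist ν₁ ν₂ :=
  Real.iSup_nonneg fun _ => abs_nonneg _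

/-- From `F⁻¹a - G⁻¹b = (a - b)/G + F⁻¹a · (G - F)/G` and `F⁻¹a ≤ 1`. If `F = 0`, then `G ≤ e` and
the bound exceeds the trivial one. -/
lemma abs_inv_mul_sub_inv_mul_le {a b F G e : ℝ} (ha : 0 ≤ a) (haF : a ≤ F) (hb : 0 ≤ b)
    (hbG : b ≤ G) (hG : 0 < G) (hab : |a - b| ≤ e) (hFG : |F - G| ≤ e) :
    |F⁻¹ * a - G⁻¹ * b| ≤ 2 * e / G := by
  rcases (ha.trans haF).eq_or_lt with hF | hF
  · subst hF
    have : G ≤ e := by rw [zero_sub, abs_neg, abs_of_pos hG] at hFG; exact hFG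
    have h1 : G⁻¹ * b ≤ 1 := by rw [inv_mul_le_iff₀ hG]; linarith
    have h2 : 1 ≤ 2 * e / G := by rw [le_div_iff₀ hG]; linarith
    rw [inv_zero, zero_mul, zero_sub, abs_neg, abs_of_nonneg (by positivity)]
    linarith
  · have h1 : F⁻¹ * a - G⁻¹ * b = (a - b) / G + (F⁻¹ * a) * ((G - F) / G) := by
      field_simp; ring
    have h2 : F⁻¹ * a ≤ 1 := by rw [inv_mul_le_iff₀ hF]; linarith
    have h3 : |F⁻¹ * a| = F⁻¹ * a := abs_of_nonneg (by positivity)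
    rw [h1]
    refine (abs_add_le _ _).trans ?_
    rw [abs_mul, abs_div, abs_div, abs_of_pos hG, h3, abs_sub_comm G F]
    have h4 : F⁻¹ * a * (|F - G| / G) ≤ 1 * (e / G) := by gcongr
    have h5 : |a - b| / G ≤ e / G := by gcongr
    calc _ ≤ e / G + 1 * (e / G) := add_le_add h5 h4
      _ = 2 * e / G := by ring

lemma abs_measureReal_withDensity_sub_le {ν : Measure E} {f g : E → ℝ} (hf : Measurable f)
    (hg : Measurable g)
    (hG : ∫⁻ x, ENNReal.ofReal (g x) ∂ν ≠ ⊤) (hE : ∫⁻ x, ENNReal.ofReal |f x - g x| ∂ν ≠ ⊤)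
    {A : Set E} (hA : MeasurableSet A) :
    |(ν.withDensity fun x => ENNReal.ofReal (f x)).real A -
      (ν.withDensity fun x => ENNReal.ofReal (g x)).real A| ≤
      (∫⁻ x, ENNReal.ofReal |f x - g x| ∂ν).toReal := by
  have key : ∀ u v : E → ℝ, Measurable u → Measurable v →
      (ν.withDensity fun x => ENNReal.ofReal (u x)) A ≤
      (ν.withDensity fun x => ENNReal.ofReal (v x)) A + ∫⁻ x, ENNReal.ofReal |u x - v x| ∂ν := by
    intro u v hu hv
    rw [withDensity_apply _ hA, withDensity_apply _ hA]
    calc ∫⁻ x in A, ENNReal.ofReal (u x) ∂ν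
        ≤ ∫⁻ x in A, (ENNReal.ofReal (v x) + ENNReal.ofReal |u x - v x|) ∂ν := by
          refine lintegral_mono fun x => ?_
          refine le_trans (ENNReal.ofReal_le_ofReal ?_) ENNReal.ofReal_add_le
          linarith [le_abs_self (u x - v x)]
      _ = _ := lintegral_add_left (by fun_prop) _
      _ ≤ _ := add_le_add le_rfl (setLIntegral_le_lintegral _ _)
  have h1 := key f g hf hg
  have h2 := key g f hg hf
  simp only [abs_sub_comm (g _) (f _)] at h2
  have hgA : (ν.withDensity fun x => ENNReal.ofReal (g x)) A ≠ ⊤ := by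
    rw [withDensity_apply _ hA]; exact ne_top_of_le_ne_top hG (setLIntegral_le_lintegral _ _)
  have hfA : (ν.withDensity fun x => ENNReal.ofReal (f x)) A ≠ ⊤ :=
    ne_top_of_le_ne_top (ENNReal.add_ne_top.2 ⟨hgA, hE⟩) h1
  have h1' := ENNReal.toReal_mono (ENNReal.add_ne_top.2 ⟨hgA, hE⟩) h1
  have h2' := ENNReal.toReal_mono (ENNReal.add_ne_top.2 ⟨hfA, hE⟩) h2
  rw [ENNReal.toReal_add hgA hE] at h1'
  rw [ENNReal.toReal_add hfA hE] at h2'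
  rw [abs_le]
  simp only [Measure.real]
  constructor <;> linarith

/-- Total variation between normalized densities is controlled by the `L¹` distance of the
unnormalized ones, one of them rescaled arbitrarily. -/
lemma tvDist_normalizeMeasure_withDensity_le {ν : Measure E} {f g : E → ℝ} (hf : Measurable f)
    (hg : Measurable g) (hG0 : ∫⁻ x, ENNReal.ofReal (g x) ∂ν ≠ 0)
    (hG : ∫⁻ x, ENNReal.ofReal (g x) ∂ν ≠ ⊤) {s : ℝ} (hs : 0 ≤ s) :
    ENNReal.ofReal (tvDist (normalizeMeasure (ν.withDensity fun x => ENNReal.ofReal (f x)))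
      (normalizeMeasure (ν.withDensity fun x => ENNReal.ofReal (g x)))) ≤
    2 * (∫⁻ x, ENNReal.ofReal |s * f x - g x| ∂ν) / ∫⁻ x, ENNReal.ofReal (g x) ∂ν := by
  set Γ := ∫⁻ x, ENNReal.ofReal (g x) ∂ν with hΓ
  have hone : ∀ e : ENNReal, Γ ≤ e → (1 : ENNReal) ≤ 2 * e / Γ := by
    intro e he
    rw [ENNReal.le_div_iff_mul_le (Or.inl hG0) (Or.inl hG), one_mul]
    calc Γ ≤ e := he
      _ = 1 * e := (one_mul e).symm
      _ ≤ 2 * e := by gcongr; norm_num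
  -- With `s = 0` the `L¹` distance is at least `∫ g`, so the right side is at least 1 and nothing
  -- is claimed.
  rcases hs.eq_or_lt with rfl | hs
  · refine le_trans ?_ (hone _ ?_)
    · simpa using tvDist_normalizeMeasure_le_one _ _
    · simp only [zero_mul, zero_sub, abs_neg]
      exact lintegral_mono fun x => ENNReal.ofReal_le_ofReal (le_abs_self _)
  by_cases hE : ∫⁻ x, ENNReal.ofReal |s * f x - g x| ∂ν = ⊤
  · rw [hE, ENNReal.mul_top (by norm_num), ENNReal.top_div_of_ne_top hG]; exact le_top
  have hscale : (ν.withDensity fun x => ENNReal.ofReal (s * f x)) =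
      ENNReal.ofReal s • ν.withDensity fun x => ENNReal.ofReal (f x) := by
    rw [← withDensity_smul _ (by fun_prop)]
    congr 1; ext x; simp [ENNReal.ofReal_mul hs.le]
  rw [← normalizeMeasure_smul (ν.withDensity fun x => ENNReal.ofReal (f x))
    (ENNReal.ofReal_pos.2 hs).ne' ENNReal.ofReal_ne_top, ← hscale]
  set κ := ν.withDensity fun x => ENNReal.ofReal (s * f x)
  set γ := ν.withDensity fun x => ENNReal.ofReal (g x) with hγ
  set e := ∫⁻ x, ENNReal.ofReal |s * f x - g x| ∂ν with he
  have hdiff : ∀ A, MeasurableSet A → |κ.real A - γ.real A| ≤ e.toReal := fun A hA =>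
    abs_measureReal_withDensity_sub_le (hf.const_mul s) hg hG hE hA
  have hγu : γ Set.univ = Γ := by rw [hγ, withDensity_apply _ MeasurableSet.univ]; simp [hΓ]
  have hγr : γ.real Set.univ = Γ.toReal := by rw [Measure.real, hγu]
  have hΓpos : 0 < Γ.toReal := ENNReal.toReal_pos hG0 hG
  have : IsFiniteMeasure γ := ⟨by rw [hγu]; exact hG.lt_top⟩
  have hκu : κ Set.univ ≠ ⊤ := by
    rw [withDensity_apply _ MeasurableSet.univ, Measure.restrict_univ]
    refine ne_top_of_le_ne_top (ENNReal.add_ne_top.2 ⟨hG, hE⟩) ?_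
    rw [hΓ, he, ← lintegral_add_left (by fun_prop)]
    refine lintegral_mono fun x => le_trans (ENNReal.ofReal_le_ofReal ?_) ENNReal.ofReal_add_le
    linarith [le_abs_self (s * f x - g x)]
  have : IsFiniteMeasure κ := ⟨hκu.lt_top⟩
  have hle : tvDist (normalizeMeasure κ) (normalizeMeasure γ) ≤ 2 * e.toReal / Γ.toReal := by
    have : Nonempty {A : Set E // MeasurableSet A} := ⟨⟨∅, MeasurableSet.empty⟩⟩
    refine ciSup_le fun A => ?_
    rw [normalizeMeasure_real_apply, normalizeMeasure_real_apply, ← hγr]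
    exact abs_inv_mul_sub_inv_mul_le measureReal_nonneg (measureReal_mono (Set.subset_univ _))
      measureReal_nonneg (measureReal_mono (Set.subset_univ _)) (hγr ▸ hΓpos) (hdiff A A.2)
      (hdiff _ MeasurableSet.univ)
  refine (ENNReal.ofReal_le_ofReal hle).trans (le_of_eq ?_)
  rw [ENNReal.ofReal_div_of_pos hΓpos, ENNReal.ofReal_mul (by norm_num), ENNReal.ofReal_toReal hE,
    ENNReal.ofReal_toReal hG]
  simp

end Normalize

/-! ### Change of variables to the local parameter -/

section LocalLaw

variable {d : ℕ}

/-- The unnormalized density of the local parameter `h = √n (θ - c)`. -/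
noncomputable def localDensity (Θ : Set (Par d)) (ϖ ℓ : Par d → ℝ) (n : ℕ) (c h : Par d) : ℝ :=
  ℓ (c + (Real.sqrt n)⁻¹ • h) * Θ.indicator ϖ (c + (Real.sqrt n)⁻¹ • h)

lemma map_volume_smul_sub {r : ℝ} (hr : r ≠ 0) (c : Par d) :
    (volume : Measure (Par d)).map (fun θ => r • (θ - c)) =
      ENNReal.ofReal (abs (r ^ Module.finrank ℝ (Par d))⁻¹) • volume := by
  have : (fun θ : Par d => r • (θ - c)) = (fun x => r • x) ∘ fun θ => θ - c := rfl
  rw [this, ← Measure.map_map (by fun_prop) (by fun_prop), map_sub_right_eq_self,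
    Measure.map_addHaar_smul _ hr]

/-- Under the affine map Lebesgue measure is only multiplied by a constant Jacobian, and
normalization removes it. -/
lemma localLaw_posterior {Θ : Set (Par d)} (hΘ : MeasurableSet Θ) {ϖ ℓ : Par d → ℝ}
    (hϖ : Measurable (Θ.indicator ϖ)) (hℓ : Measurable ℓ) {n : ℕ} (hn : 0 < n) (c : Par d) :
    localLaw n c (posterior Θ ϖ ℓ) =
      normalizeMeasure (volume.withDensity fun h =>
        ENNReal.ofReal (localDensity Θ ϖ ℓ n c h)) := by
  have hr : Real.sqrt n ≠ 0 := (Real.sqrt_pos.2 (by exact_mod_cast hn)).ne'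
  have hunnorm : unnormPosterior Θ ϖ ℓ = volume.withDensity fun θ =>
      ENNReal.ofReal (localDensity Θ ϖ ℓ n c (Real.sqrt n • (θ - c))) := by
    rw [unnormPosterior, ← withDensity_indicator hΘ]
    congr 1
    ext θ
    by_cases h : θ ∈ Θ <;> simp [localDensity, smul_smul, inv_mul_cancel₀ hr, h]
  have hm : Measurable fun h => localDensity Θ ϖ ℓ n c h :=
    (hℓ.comp (by fun_prop)).mul (hϖ.comp (by fun_prop))
  change (normalizeMeasure (unnormPosterior Θ ϖ ℓ)).map _ = _
  rw [normalizeMeasure_map _ (by fun_prop), hunnorm,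
    map_withDensity_comp volume (f := fun θ => Real.sqrt n • (θ - c)) (by fun_prop)
      (g := fun h => ENNReal.ofReal (localDensity Θ ϖ ℓ n c h)) (by fun_prop),
    map_volume_smul_sub hr, withDensity_smul_measure, normalizeMeasure_smul _ _ ENNReal.ofReal_ne_top]
  simp [hr]

end LocalLaw

/-! ### Gaussian measures as normalized densities -/

section Gaussian

variable {d : ℕ}

lemma integrable_exp_neg_mul_sq_norm {b : ℝ} (hb : 0 < b) :
    Integrable (fun v : Par d => Real.exp (-b * ‖v‖ ^ 2)) := by
  have h := GaussianFourier.integrable_cexp_neg_mul_sq_norm_add (V := Par d)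
    (b := (b : ℂ)) (by simpa using hb) 0 0
  refine h.re.congr (ae_of_all _ fun v => ?_)
  have : -(b : ℂ) * (‖v‖ : ℂ) ^ 2 + 0 * ((inner ℝ (0 : Par d) v : ℝ) : ℂ) =
    ((-b * ‖v‖ ^ 2 : ℝ) : ℂ) := by push_cast; ring
  simp only [this]
  rw [← Complex.ofReal_exp]
  exact Complex.ofReal_re _

/-- Characteristic functions are compared: the Gaussian Fourier integral gives `Z exp(-‖t‖²/2)`, and
`t = 0` identifies `Z` with the total mass, so its explicit value is never needed. -/
lemma stdGaussian_eq_normalizeMeasure :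
    stdGaussian (Par d) = normalizeMeasure (volume.withDensity fun v : Par d =>
      ENNReal.ofReal (Real.exp (-(1 / 2) * ‖v‖ ^ 2))) := by
  set κ : Measure (Par d) := volume.withDensity fun v : Par d =>
      ENNReal.ofReal (Real.exp (-(1 / 2) * ‖v‖ ^ 2)) with hκ
  have hint := integrable_exp_neg_mul_sq_norm (d := d) (b := 1 / 2) (by norm_num)
  have hfin : IsFiniteMeasure κ := isFiniteMeasure_withDensity_ofReal hint.2
  obtain ⟨Z, hZ0, hZ⟩ : ∃ Z : ℂ, Z ≠ 0 ∧ ∀ t : Par d,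
      charFun κ t = Z * Complex.exp (-‖t‖ ^ 2 / 2) := by
    refine ⟨(Real.pi / (1 / 2 : ℂ)) ^ (Module.finrank ℝ (Par d) / 2 : ℂ), ?_, fun t => ?_⟩
    · rw [Complex.cpow_ne_zero_iff]
      left
      simp [Real.pi_ne_zero]
    · rw [charFun_apply, hκ, integral_withDensity_eq_integral_toReal_smul (by fun_prop)
        (ae_of_all _ fun _ => ENNReal.ofReal_lt_top)]
      have h := GaussianFourier.integral_cexp_neg_mul_sq_norm_add (V := Par d)
        (b := (1 / 2 : ℂ)) (by norm_num) Complex.I t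
      have h2 : Complex.I ^ 2 * (‖t‖ : ℂ) ^ 2 / (4 * (1 / 2)) = -(‖t‖ : ℂ) ^ 2 / 2 := by
        rw [Complex.I_sq]; ring
      rw [h2] at h
      rw [← h]
      refine integral_congr_ae (ae_of_all _ fun v => ?_)
      simp only [ENNReal.toReal_ofReal (Real.exp_pos _).le, Complex.real_smul, Complex.ofReal_exp]
      rw [← Complex.exp_add, real_inner_comm]
      congr 1
      push_cast
      ring
  have hmass : ((κ.real Set.univ : ℝ) : ℂ) = Z := by
    have := hZ 0
    rwa [charFun_zero, norm_zero, Complex.ofReal_zero, zero_pow two_ne_zero, neg_zero, zero_div,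
      Complex.exp_zero, mul_one] at this
  have hκ0 : κ Set.univ ≠ 0 := by
    intro h
    apply hZ0
    rw [← hmass, Measure.real, h]; simp
  have : IsFiniteMeasure (normalizeMeasure κ) := by
    refine ⟨lt_of_le_of_lt ?_ ENNReal.one_lt_top⟩
    exact ENNReal.inv_mul_le_one _
  apply Measure.ext_of_charFun
  ext t
  rw [charFun_stdGaussian, charFun_apply, normalizeMeasure, integral_smul_measure,
    ← charFun_apply, hZ t, ENNReal.toReal_inv, ← hmass]
  change _ = ((κ.real Set.univ)⁻¹ : ℝ) • _
  have hr : ((κ.real Set.univ : ℝ) : ℂ) ≠ 0 := hmass ▸ hZ0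
  rw [Complex.real_smul, Complex.ofReal_inv, ← mul_assoc, inv_mul_cancel₀ hr, one_mul]

open scoped Matrix MatrixOrder in
-- The measure is the image of the standard Gaussian under `R = √(I₀⁻¹)`. Since `R I₀ R = 1`, the
-- form of `I₀` at `R v` is `‖v‖²`, and the determinant of `R` disappears in the normalization.
lemma multivariateGaussian_zero_inv_eq_normalizeMeasure {I₀ : Matrix (Fin d) (Fin d) ℝ}
    (hI₀ : I₀.PosDef) :
    multivariateGaussian 0 I₀⁻¹ = normalizeMeasure (volume.withDensity fun h : Par d =>
      ENNReal.ofReal (Real.exp (-(1 / 2) * (h ⬝ᵥ I₀ *ᵥ h)))) := by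
  set R : Matrix (Fin d) (Fin d) ℝ := CFC.sqrt I₀⁻¹ with hR
  have hRR : R * R = I₀⁻¹ := CFC.sqrt_mul_sqrt_self _ hI₀.inv.posSemidef.nonneg
  have hdet : IsUnit I₀.det := (Matrix.isUnit_iff_isUnit_det _).1 hI₀.isUnit
  have hRI : R * I₀ * R = 1 := by
    have h1 : R * (R * I₀) = 1 := by rw [← mul_assoc, hRR, Matrix.nonsing_inv_mul _ hdet]
    have h2 : (R * I₀) * R = 1 := mul_eq_one_comm.1 h1
    exact h2
  have hRT : Rᵀ = R := by
    have : Rᴴ = R := (CFC.sqrt_nonneg I₀⁻¹).isSelfAdjoint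
    rwa [Matrix.conjTranspose_eq_transpose_of_trivial] at this
  set A : Par d →L[ℝ] Par d := Matrix.toEuclideanCLM (𝕜 := ℝ) R with hA
  have hquad : ∀ v : Par d, (A v).ofLp ⬝ᵥ I₀ *ᵥ (A v).ofLp = ‖v‖ ^ 2 := by
    intro v
    have h1 : (A v).ofLp = R *ᵥ v.ofLp := rfl
    rw [h1, Matrix.dotProduct_mulVec, Matrix.vecMul_mulVec, ← Matrix.dotProduct_mulVec, hRT,
      Matrix.mulVec_mulVec, hRI, Matrix.one_mulVec, EuclideanSpace.real_norm_sq_eq]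
    simp [dotProduct, sq]
  have hAdet : LinearMap.det (A : Par d →ₗ[ℝ] Par d) ≠ 0 := by
    have h1 : A * (Matrix.toEuclideanCLM (𝕜 := ℝ) (I₀ * R)) = 1 := by
      rw [hA, ← map_mul, ← mul_assoc, hRI, map_one]
    intro h0
    have h2 : (A : Par d →ₗ[ℝ] Par d) *
        ((Matrix.toEuclideanCLM (𝕜 := ℝ) (I₀ * R) : Par d →L[ℝ] Par d) : Par d →ₗ[ℝ] Par d) = 1 := by
      ext1 x
      exact DFunLike.congr_fun h1 x
    have h3 := congrArg LinearMap.det h2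
    rw [map_mul, h0, zero_mul, map_one] at h3
    exact zero_ne_one h3
  have hg : Measurable fun h : Par d =>
      ENNReal.ofReal (Real.exp (-(1 / 2) * (h.ofLp ⬝ᵥ I₀ *ᵥ h.ofLp))) := by
    simp only [dotProduct, Matrix.mulVec]
    fun_prop
  have hstd : (fun v : Par d => ENNReal.ofReal (Real.exp (-(1 / 2) * ‖v‖ ^ 2))) =
      fun v => ENNReal.ofReal (Real.exp (-(1 / 2) * ((A v).ofLp ⬝ᵥ I₀ *ᵥ (A v).ofLp))) := by
    ext v; rw [hquad]
  have hmap : (volume : Measure (Par d)).map A =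
      ENNReal.ofReal |(LinearMap.det (A : Par d →ₗ[ℝ] Par d))⁻¹| • volume :=
    Measure.map_linearMap_addHaar_eq_smul_addHaar volume hAdet
  rw [multivariateGaussian, stdGaussian_eq_normalizeMeasure]
  simp only [zero_add]
  rw [normalizeMeasure_map _ (by fun_prop), hstd,
    map_withDensity_comp volume (f := fun v => A v) (by fun_prop) hg, hmap,
    withDensity_smul_measure, normalizeMeasure_smul _ _ ENNReal.ofReal_ne_top]
  simp [hAdet]

end Gaussian

/-! ### Laplace approximation by dominated convergence -/

section Laplace

variable {d : ℕ}

lemma ae_comp_add_smul {r : ℝ} (hr : r ≠ 0) (c : Par d) {p : Par d → Prop}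
    (hp : ∀ᵐ θ, p θ) : ∀ᵐ h, p (c + r • h) := by
  have hmap : (volume : Measure (Par d)).map (fun h => r • (h - (-(r⁻¹ • c)))) =
      ENNReal.ofReal (abs (r ^ Module.finrank ℝ (Par d))⁻¹) • volume := map_volume_smul_sub hr _
  have h1 : ∀ᵐ θ ∂(volume : Measure (Par d)).map (fun h => r • (h - (-(r⁻¹ • c)))), p θ := by
    rw [hmap]; exact Measure.ae_smul_measure hp _
  filter_upwards [ae_of_ae_map (by fun_prop) h1] with h hh
  rwa [sub_neg_eq_add, smul_add, smul_smul, mul_inv_cancel₀ hr, one_smul, add_comm] at hh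

lemma measurable_localDensity {Θ : Set (Par d)} {ϖ ℓ : Par d → ℝ}
    (hϖ : Measurable (Θ.indicator ϖ)) (hℓ : Measurable ℓ) (n : ℕ) (c : Par d) :
    Measurable (localDensity Θ ϖ ℓ n c) :=
  (hℓ.comp (by fun_prop)).mul (hϖ.comp (by fun_prop))

lemma measurable_indicator_of_continuousOn {Θ : Set (Par d)} (hΘ : IsCompact Θ) {ϖ : Par d → ℝ}
    (hϖ : ContinuousOn ϖ Θ) : Measurable (Θ.indicator ϖ) := by
  classical
  rw [← Set.piecewise_eq_indicator]
  exact hϖ.measurable_piecewise continuousOn_const hΘ.isClosed.measurableSet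

/-- Laplace approximation: if the log quasi-likelihood `Λ` decays quadratically around the centre
and is asymptotically quadratic on the local scale, the unnormalized local posterior density
converges to the Gaussian one in `L¹`. -/
lemma tendsto_lintegral_localDensity_sub {Θ : Set (Par d)} (hΘ : IsCompact Θ) {θ₀ : Par d}
    (hθ₀ : θ₀ ∈ interior Θ) {ϖ : Par d → ℝ} (hϖ : ContinuousOn ϖ Θ) (hϖ₀ : 0 < ϖ θ₀)
    {n : ℕ → ℕ} (hn : Tendsto n atTop atTop) {c : ℕ → Par d} (hc : Tendsto c atTop (𝓝 θ₀))
    {Λ R : ℕ → Par d → ℝ} (hR : ∀ k, Measurable (R k)) {q : Par d → ℝ} (hq : Measurable q)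
    (hqint : Integrable fun h => Real.exp (-(1 / 2) * q h)) {a : ℝ} (ha : 0 < a)
    (hΛ : ∀ᶠ k in atTop, ∀ θ ∈ Θ, Λ k θ ≤ -a * (n k * ‖θ - c k‖ ^ 2))
    (hlim : ∀ h, Tendsto (fun k => Λ k (c k + (Real.sqrt (n k))⁻¹ • h)) atTop
      (𝓝 (-(1 / 2) * q h)))
    {η : ℕ → ℝ} (hη : Tendsto η atTop (𝓝 0))
    (hRΛ : ∀ᶠ k in atTop, ∀ᵐ θ ∂volume.restrict Θ,
      |R k θ - Real.exp (Λ k θ)| ≤ η k * Real.exp (Λ k θ)) :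
    Tendsto (fun k => ∫⁻ h, ENNReal.ofReal
      |(ϖ θ₀)⁻¹ * localDensity Θ ϖ (R k) (n k) (c k) h - Real.exp (-(1 / 2) * q h)|)
      atTop (𝓝 0) := by
  obtain ⟨B, hB⟩ := hΘ.exists_bound_of_continuousOn hϖ
  have hB0 : 0 ≤ B := (norm_nonneg _).trans (hB θ₀ (interior_subset hθ₀))
  have hnpos : ∀ᶠ k in atTop, 0 < n k := hn.eventually_gt_atTop 0
  have hae : ∀ᶠ k in atTop, ∀ᵐ h : Par d, c k + (Real.sqrt (n k))⁻¹ • h ∈ Θ →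
      |R k (c k + (Real.sqrt (n k))⁻¹ • h) - Real.exp (Λ k (c k + (Real.sqrt (n k))⁻¹ • h))| ≤
        η k * Real.exp (Λ k (c k + (Real.sqrt (n k))⁻¹ • h)) := by
    filter_upwards [hRΛ, hnpos] with k hk hnk
    rw [ae_restrict_iff' hΘ.isClosed.measurableSet] at hk
    exact ae_comp_add_smul (inv_ne_zero (Real.sqrt_pos.2 (by exact_mod_cast hnk)).ne') (c k) hk
  -- In local coordinates `n‖θ - c‖²` is `‖h‖²`, so the bound on `Λ` becomes a Gaussian tail free of
  -- `k`.
  have hnorm : ∀ k, 0 < n k → ∀ h : Par d,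
      (n k : ℝ) * ‖c k + (Real.sqrt (n k))⁻¹ • h - c k‖ ^ 2 = ‖h‖ ^ 2 := by
    intro k hnk h
    have : (0 : ℝ) < n k := by exact_mod_cast hnk
    rw [add_sub_cancel_left, norm_smul, mul_pow, Real.norm_eq_abs, sq_abs, inv_pow,
      Real.sq_sqrt this.le, ← mul_assoc, mul_inv_cancel₀ this.ne', one_mul]
  have hzero : ∫⁻ _ : Par d, (0 : ENNReal) = 0 := lintegral_zero
  rw [← hzero]
  -- The factor `2B` comes from `|R| ≤ 2 exp Λ`, valid once `η k ≤ 1`, and from `|ϖ| ≤ B` on `Θ`.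
  refine tendsto_lintegral_filter_of_dominated_convergence
    (fun h => ENNReal.ofReal ((ϖ θ₀)⁻¹ * (2 * B) * Real.exp (-a * ‖h‖ ^ 2) +
      Real.exp (-(1 / 2) * q h))) ?_ ?_ ?_ ?_
  · refine Eventually.of_forall fun k => ?_
    have := measurable_localDensity (measurable_indicator_of_continuousOn hΘ hϖ) (hR k) (n k) (c k)
    fun_prop
  · filter_upwards [hae, hnpos, hΛ, hη.eventually (ge_mem_nhds zero_lt_one)]
      with k hk hnk hΛk hηk
    filter_upwards [hk] with h hh
    refine ENNReal.ofReal_le_ofReal ((abs_sub _ _).trans ?_)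
    rw [abs_of_pos (Real.exp_pos (-(1 / 2) * q h))]
    gcongr
    rw [abs_mul, abs_of_pos (inv_pos.2 hϖ₀), mul_assoc]
    gcongr
    unfold localDensity
    by_cases hmem : c k + (Real.sqrt (n k))⁻¹ • h ∈ Θ
    · rw [Set.indicator_of_mem hmem, abs_mul]
      have h1 := hh hmem
      have h2 := hΛk _ hmem
      rw [hnorm k hnk] at h2
      have h3 : |R k (c k + (Real.sqrt (n k))⁻¹ • h)| ≤ 2 * Real.exp (-a * ‖h‖ ^ 2) := by
        have h4 := Real.exp_le_exp.2 h2
        have h5 := Real.exp_pos (Λ k (c k + (Real.sqrt (n k))⁻¹ • h))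
        have h6 : η k * Real.exp (Λ k (c k + (Real.sqrt (n k))⁻¹ • h)) ≤
          1 * Real.exp (Λ k (c k + (Real.sqrt (n k))⁻¹ • h)) := by gcongr
        rw [abs_le] at h1 ⊢
        constructor <;> linarith [h1.1, h1.2]
      calc _ ≤ (2 * Real.exp (-a * ‖h‖ ^ 2)) * B :=
            mul_le_mul h3 (hB _ hmem) (abs_nonneg _) (by positivity)
        _ = _ := by ring
    · rw [Set.indicator_of_notMem hmem, mul_zero, abs_zero]
      positivity
  · refine (Integrable.lintegral_lt_top ?_).ne
    exact ((integrable_exp_neg_mul_sq_norm ha).const_mul _).add hqint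
  · obtain ⟨N, hN⟩ := eventually_atTop.1 hae
    -- The exceptional null sets depend on `k`; their countable union lets the limit be taken at a
    -- fixed `h`.
    have hall : ∀ᵐ h : Par d, ∀ k, N ≤ k → c k + (Real.sqrt (n k))⁻¹ • h ∈ Θ →
      |R k (c k + (Real.sqrt (n k))⁻¹ • h) - Real.exp (Λ k (c k + (Real.sqrt (n k))⁻¹ • h))| ≤
        η k * Real.exp (Λ k (c k + (Real.sqrt (n k))⁻¹ • h)) := by
      rw [ae_all_iff]; intro k
      by_cases hk : N ≤ k
      · filter_upwards [hN k hk] with h hh _ using hh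
      · exact ae_of_all _ fun h hk' => absurd hk' hk
    filter_upwards [hall] with h hh
    have hθ : Tendsto (fun k => c k + (Real.sqrt (n k))⁻¹ • h) atTop (𝓝 θ₀) := by
      have h1 : Tendsto (fun k => (Real.sqrt (n k))⁻¹) atTop (𝓝 0) :=
        tendsto_inv_atTop_zero.comp (Real.tendsto_sqrt_atTop.comp
          (tendsto_natCast_atTop_atTop.comp hn))
      simpa using hc.add (h1.smul_const h)
    have hΘn : Θ ∈ 𝓝 θ₀ := mem_interior_iff_mem_nhds.1 hθ₀
    have hmem := hθ.eventually hΘn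
    have hexp : Tendsto (fun k => Real.exp (Λ k (c k + (Real.sqrt (n k))⁻¹ • h))) atTop
        (𝓝 (Real.exp (-(1 / 2) * q h))) := (Real.continuous_exp.tendsto _).comp (hlim h)
    have hRlim : Tendsto (fun k => R k (c k + (Real.sqrt (n k))⁻¹ • h)) atTop
        (𝓝 (Real.exp (-(1 / 2) * q h))) := by
      have h1 : Tendsto (fun k => R k (c k + (Real.sqrt (n k))⁻¹ • h) -
          Real.exp (Λ k (c k + (Real.sqrt (n k))⁻¹ • h))) atTop (𝓝 0) := by
        refine squeeze_zero_norm' ?_ (by simpa using hη.mul hexp)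
        filter_upwards [hmem, eventually_ge_atTop N] with k hk hNk using hh k hNk hk
      simpa using h1.add hexp
    have hϖlim : Tendsto (fun k => Θ.indicator ϖ (c k + (Real.sqrt (n k))⁻¹ • h)) atTop
        (𝓝 (ϖ θ₀)) := by
      refine (((hϖ.continuousAt hΘn).tendsto.comp hθ)).congr' ?_
      filter_upwards [hmem] with k hk
      simp [Set.indicator_of_mem hk]
    have hfin := ((hRlim.mul hϖlim).const_mul (ϖ θ₀)⁻¹).sub_const (Real.exp (-(1 / 2) * q h))
    have hval : (ϖ θ₀)⁻¹ * (Real.exp (-(1 / 2) * q h) * ϖ θ₀) - Real.exp (-(1 / 2) * q h) = 0 := by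
      field_simp; ring
    rw [hval] at hfin
    simpa [localDensity] using ENNReal.tendsto_ofReal hfin.abs

end Laplace

/-! ### Second order Taylor expansion and derivative bounds -/

section Taylor

variable {d : ℕ}

/-- Cauchy's mean value theorem against `t²` gives `φ 1 - φ 0 = φ' s / (2 s)`, and the mean value
theorem for `φ'` on `[0, s]` finishes. Continuity of `φ''` is not needed. -/
lemma exists_sub_eq_half_second_deriv {φ φ' φ'' : ℝ → ℝ}
    (h1 : ∀ t ∈ Set.Icc (0 : ℝ) 1, HasDerivAt φ (φ' t) t)
    (h2 : ∀ t ∈ Set.Icc (0 : ℝ) 1, HasDerivAt φ' (φ'' t) t) (h0 : φ' 0 = 0) :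
    ∃ t ∈ Set.Ioo (0 : ℝ) 1, φ 1 - φ 0 = φ'' t / 2 := by
  obtain ⟨s, hs, hs'⟩ := exists_ratio_hasDerivAt_eq_ratio_slope φ φ' zero_lt_one
    (fun t ht => (h1 t ht).continuousAt.continuousWithinAt)
    (fun t ht => h1 t (Set.Ioo_subset_Icc_self ht)) (fun t => t ^ 2) (fun t => 2 * t)
    (by fun_prop) (fun t _ => by simpa using hasDerivAt_pow 2 t)
  have hsub : ∀ t ∈ Set.Icc 0 s, t ∈ Set.Icc (0 : ℝ) 1 := fun t ht => ⟨ht.1, ht.2.trans hs.2.le⟩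
  obtain ⟨t, ht, ht'⟩ := exists_hasDerivAt_eq_slope φ' φ'' hs.1
    (fun t ht => (h2 t (hsub t ht)).continuousAt.continuousWithinAt)
    (fun t ht => h2 t (hsub t (Set.Ioo_subset_Icc_self ht)))
  refine ⟨t, ⟨ht.1, ht.2.trans hs.2⟩, ?_⟩
  have hs0 := hs.1.ne'
  rw [ht', h0]
  field_simp
  linarith

lemma differentiableAt_of_iteratedFDeriv_zero {f : Par d → ℝ} {x : Par d}
    (h : DifferentiableAt ℝ (iteratedFDeriv ℝ 0 f) x) : DifferentiableAt ℝ f x := by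
  rw [iteratedFDeriv_zero_eq_comp] at h
  exact (LinearIsometryEquiv.comp_differentiableAt_iff _).1 h

lemma differentiableAt_fderiv_of_iteratedFDeriv_one {f : Par d → ℝ} {x : Par d}
    (h : DifferentiableAt ℝ (iteratedFDeriv ℝ 1 f) x) : DifferentiableAt ℝ (fderiv ℝ f) x := by
  have h1 : fderiv ℝ f = fun y =>
      continuousMultilinearCurryFin1 ℝ (Par d) ℝ (iteratedFDeriv ℝ 1 f y) := by
    ext y v
    simp [iteratedFDeriv_one_apply]
  rw [h1]
  exact (continuousMultilinearCurryFin1 ℝ (Par d)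
    ℝ).toContinuousLinearEquiv.differentiableAt.comp x h

/-- Second order Taylor formula at a critical point. -/
lemma exists_sub_eq_half_iteratedFDeriv_two {f : Par d → ℝ} {s : Set (Par d)} (hs : Convex ℝ s)
    (hf : ∀ x ∈ s, ∀ k < 2, DifferentiableAt ℝ (iteratedFDeriv ℝ k f) x) {c θ : Par d}
    (hc : c ∈ s) (hθ : θ ∈ s) (hgrad : HasGradientAt f 0 c) :
    ∃ t ∈ Set.Ioo (0 : ℝ) 1,
      f θ - f c = iteratedFDeriv ℝ 2 f (c + t • (θ - c)) (fun _ => θ - c) / 2 := by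
  have hmem : ∀ t ∈ Set.Icc (0 : ℝ) 1, c + t • (θ - c) ∈ s := fun t ht =>
    hs.add_smul_sub_mem hc hθ ht
  have hline : ∀ t : ℝ, HasDerivAt (fun t : ℝ => c + t • (θ - c)) (θ - c) t := fun t => by
    simpa using ((hasDerivAt_id t).smul_const (θ - c)).const_add c
  have h1 : ∀ t ∈ Set.Icc (0 : ℝ) 1, HasDerivAt (fun t => f (c + t • (θ - c)))
      (fderiv ℝ f (c + t • (θ - c)) (θ - c)) t := fun t ht =>
    (differentiableAt_of_iteratedFDeriv_zero
      (hf _ (hmem t ht) 0 (by norm_num))).hasFDerivAt.comp_hasDerivAt t (hline t)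
  have h2 : ∀ t ∈ Set.Icc (0 : ℝ) 1,
      HasDerivAt (fun t : ℝ => fderiv ℝ f (c + t • (θ - c)) (θ - c))
      (iteratedFDeriv ℝ 2 f (c + t • (θ - c)) (fun _ => θ - c)) t := by
    intro t ht
    have h := (differentiableAt_fderiv_of_iteratedFDeriv_one
      (hf _ (hmem t ht) 1 (by norm_num))).hasFDerivAt.comp_hasDerivAt t (hline t)
    rw [iteratedFDeriv_two_apply]
    exact (h.clm_apply (hasDerivAt_const t (θ - c))).congr_deriv (by simp)
  have h3 : fderiv ℝ f c = 0 := by rw [hgrad.hasFDerivAt.fderiv]; simp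
  obtain ⟨t, ht, h⟩ := exists_sub_eq_half_second_deriv h1 h2 (by simp [h3])
  exact ⟨t, ht, by simpa using h⟩

lemma multilinear_apply_eq_sum {k : ℕ} (T : ContinuousMultilinearMap ℝ (fun _ : Fin k => Par d) ℝ)
    (v : Fin k → Par d) :
    T v = ∑ l : Fin k → Fin d, (∏ i, v i (l i)) * T fun i => EuclideanSpace.single (l i) 1 := by
  have hv : v = fun i => ∑ j, v i j • EuclideanSpace.single j (1 : ℝ) := by
    ext i j
    simp [Finset.sum_apply, Pi.single_apply]
  conv_lhs => rw [hv]
  rw [ContinuousMultilinearMap.map_sum]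
  refine Finset.sum_congr rfl fun l _ => ?_
  rw [ContinuousMultilinearMap.map_smul_univ, smul_eq_mul]

/-- Expanding in coordinates gives `d ^ k` terms, each at most `M ∏ ‖v i‖`. This turns the envelope
on partial derivatives into an operator norm bound. -/
lemma norm_iteratedFDeriv_le_of_partialDeriv {k : ℕ} {f : Par d → ℝ} {x : Par d} {M : ℝ}
    (hM0 : 0 ≤ M) (hM : ∀ l : Fin k → Fin d, |partialDeriv k l f x| ≤ M) :
    ‖iteratedFDeriv ℝ k f x‖ ≤ (d : ℝ) ^ k * M := by
  refine ContinuousMultilinearMap.opNorm_le_bound (by positivity) fun v => ?_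
  rw [multilinear_apply_eq_sum]
  refine (norm_sum_le _ _).trans ?_
  have : ∀ l ∈ (Finset.univ : Finset (Fin k → Fin d)),
      ‖(∏ i, v i (l i)) * iteratedFDeriv ℝ k f x fun i => EuclideanSpace.single (l i) 1‖ ≤
        (∏ i, ‖v i‖) * M := by
    intro l _
    rw [norm_mul, norm_prod]
    gcongr with i
    · exact PiLp.norm_apply_le (v i) (l i)
    · exact hM l
  refine (Finset.sum_le_card_nsmul _ _ _ this).trans (le_of_eq ?_)
  simp
  ring

lemma norm_iteratedFDeriv_two_sub_le {f : Par d → ℝ} {s : Set (Par d)} (hs : Convex ℝ s)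
    {M : ℝ} (hM0 : 0 ≤ M) (hf : ∀ x ∈ s, DifferentiableAt ℝ (iteratedFDeriv ℝ 2 f) x)
    (hM : ∀ x ∈ s, ∀ l : Fin 3 → Fin d, |partialDeriv 3 l f x| ≤ M) {x y : Par d}
    (hx : x ∈ s) (hy : y ∈ s) :
    ‖iteratedFDeriv ℝ 2 f y - iteratedFDeriv ℝ 2 f x‖ ≤ (d : ℝ) ^ 3 * M * ‖y - x‖ := by
  refine hs.norm_image_sub_le_of_norm_fderiv_le hf (fun z hz => ?_) hx hy
  rw [norm_fderiv_iteratedFDeriv]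
  exact norm_iteratedFDeriv_le_of_partialDeriv hM0 (hM z hz)

end Taylor

/-! ### Quadratic bound and local quadratic limit of the log-likelihood -/

section LogLikelihoodExpansion

variable {d : ℕ}

/-- Within the ball, Taylor's formula at `c k` and the curvature give the constant `c₁ / 2`. Outside
it the gap `κ m` suffices because `‖θ - c k‖²` is at most `V` on the bounded set `Θ`, which gives `κ
/ V`. -/
lemma mul_sub_le_of_curvature_of_separation {Θ : Set (Par d)} (hΘ : IsCompact Θ) {θ₀ : Par d}
    {f : ℕ → Par d → ℝ} {c : ℕ → Par d} {m K : ℕ → ℕ} {r c₁ κ : ℝ} (hr : 0 < r) (hc₁ : 0 < c₁)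
    (hκ : 0 < κ) (hm : ∀ᶠ k in atTop, 0 < m k)
    (hdiff : ∀ᶠ k in atTop, ∀ θ ∈ Metric.ball θ₀ r, ∀ i < 3,
      DifferentiableAt ℝ (iteratedFDeriv ℝ i (f k)) θ)
    (hcurv : ∀ᶠ k in atTop, ∀ θ ∈ Metric.ball θ₀ r, ∀ v : Par d,
      c₁ * ‖v‖ ^ 2 ≤ -(iteratedFDeriv ℝ 2 (f k) θ fun _ => v) / m k)
    (hc : Tendsto c atTop (𝓝 θ₀)) (hcΘ : ∀ᶠ k in atTop, c k ∈ Θ)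
    (hgrad : ∀ᶠ k in atTop, HasGradientAt (f k) 0 (c k))
    (hsep : ∀ᶠ k in atTop, ∀ θ ∈ Θ, r ≤ ‖θ - θ₀‖ → f k θ - f k (c k) ≤ -κ * m k) :
    ∃ a > 0, ∀ᶠ k in atTop, ∀ θ ∈ Θ,
      (K k : ℝ) * (f k θ - f k (c k)) ≤ -a * (((m k * K k : ℕ) : ℝ) * ‖θ - c k‖ ^ 2) := by
  obtain ⟨W, hW⟩ := hΘ.isBounded.exists_norm_le
  -- The summand 1 only keeps `V` positive.
  set V : ℝ := (2 * W) ^ 2 + 1 with hV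
  have hVpos : 0 < V := by positivity
  refine ⟨min (c₁ / 2) (κ / V), by positivity, ?_⟩
  filter_upwards [hm, hdiff, hcurv, hc.eventually (Metric.ball_mem_nhds θ₀ hr), hcΘ, hgrad, hsep]
    with k hmk hdk hck hcb hckΘ hgk hsk θ hθ
  have hmk' : (0 : ℝ) < m k := by exact_mod_cast hmk
  have key : f k θ - f k (c k) ≤ -(min (c₁ / 2) (κ / V)) * (m k * ‖θ - c k‖ ^ 2) := by
    by_cases hball : θ ∈ Metric.ball θ₀ r
    · obtain ⟨t, ht, hexp⟩ := exists_sub_eq_half_iteratedFDeriv_two (convex_ball θ₀ r)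
        (fun x hx i hi => hdk x hx i (by omega)) hcb hball hgk
      have h1 := hck _ ((convex_ball θ₀ r).add_smul_sub_mem hcb hball
        (Set.Ioo_subset_Icc_self ht)) (θ - c k)
      rw [le_div_iff₀ hmk'] at h1
      have h2 : min (c₁ / 2) (κ / V) * (m k * ‖θ - c k‖ ^ 2) ≤
          c₁ / 2 * (m k * ‖θ - c k‖ ^ 2) := by gcongr; exact min_le_left _ _
      rw [hexp]
      linarith
    · have h1 := hsk θ hθ (by simpa [dist_eq_norm] using hball)
      have h2 : ‖θ - c k‖ ^ 2 ≤ V := by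
        have h3 : ‖θ - c k‖ ≤ 2 * W := (norm_sub_le _ _).trans (by
          linarith [hW θ hθ, hW _ hckΘ])
        have h4 : ‖θ - c k‖ ^ 2 ≤ (2 * W) ^ 2 := by gcongr
        linarith
      have h3 : min (c₁ / 2) (κ / V) * (m k * ‖θ - c k‖ ^ 2) ≤ κ / V * (m k * V) := by
        gcongr; exact min_le_right _ _
      have h4 : κ / V * (m k * V) = κ * m k := by field_simp
      linarith
  have h5 := mul_le_mul_of_nonneg_left key (Nat.cast_nonneg (K k) : (0 : ℝ) ≤ K k)
  refine h5.trans (le_of_eq ?_)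
  push_cast
  ring

/-- The Hessian at the intermediate Taylor point differs from the one at `θ₀` by `O(m)` times their
distance, which tends to 0. Convergence of the information is therefore needed only at `θ₀` itself.
-/
lemma tendsto_mul_sub_local {θ₀ : Par d} {I₀ : Matrix (Fin d) (Fin d) ℝ}
    {f : ℕ → Par d → ℝ} {c : ℕ → Par d} {m K : ℕ → ℕ} {r D : ℝ} (hr : 0 < r) (hD : 0 ≤ D)
    (hm : ∀ᶠ k in atTop, 0 < m k) (hn : Tendsto (fun k => m k * K k) atTop atTop)
    (hdiff : ∀ᶠ k in atTop, ∀ θ ∈ Metric.ball θ₀ r, ∀ i < 3,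
      DifferentiableAt ℝ (iteratedFDeriv ℝ i (f k)) θ)
    (hthird : ∀ᶠ k in atTop, ∀ θ ∈ Metric.ball θ₀ r, ∀ l : Fin 3 → Fin d,
      |partialDeriv 3 l (f k) θ| ≤ D * m k)
    (hinfo : ∀ i j, Tendsto (fun k => -(partialDeriv 2 ![i, j] (f k) θ₀) / m k) atTop
      (𝓝 (I₀ i j)))
    (hc : Tendsto c atTop (𝓝 θ₀)) (hgrad : ∀ᶠ k in atTop, HasGradientAt (f k) 0 (c k))
    (h : Par d) :
    Tendsto (fun k => (K k : ℝ) * (f k (c k + (Real.sqrt ((m k * K k : ℕ) : ℝ))⁻¹ • h) - f k (c k)))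
      atTop (𝓝 (-(1 / 2) * (h.ofLp ⬝ᵥ I₀.mulVec h.ofLp))) := by
  set u : ℕ → ℝ := fun k => (Real.sqrt ((m k * K k : ℕ) : ℝ))⁻¹ with hu
  have hu0 : Tendsto u atTop (𝓝 0) :=
    tendsto_inv_atTop_zero.comp (Real.tendsto_sqrt_atTop.comp
      (tendsto_natCast_atTop_atTop.comp hn))
  have hθ : Tendsto (fun k => c k + u k • h) atTop (𝓝 θ₀) := by
    simpa using hc.add (hu0.smul_const h)
  -- the quadratic form at the true parameter
  have hquad : Tendsto (fun k => -(iteratedFDeriv ℝ 2 (f k) θ₀ fun _ => h) / m k) atTop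
      (𝓝 (h.ofLp ⬝ᵥ I₀.mulVec h.ofLp)) := by
    have hval : h.ofLp ⬝ᵥ I₀.mulVec h.ofLp =
        ∑ l : Fin 2 → Fin d, (∏ i, h (l i)) * I₀ (l 0) (l 1) := by
      simp only [dotProduct, Matrix.mulVec, Finset.mul_sum, Fin.prod_univ_two]
      rw [← Finset.sum_product', ← (finTwoArrowEquiv (Fin d)).symm.sum_comp]
      refine Finset.sum_congr (by simp) fun p _ => ?_
      simp [finTwoArrowEquiv]
      ring
    rw [hval]
    have hterm : ∀ k, -(iteratedFDeriv ℝ 2 (f k) θ₀ fun _ => h) / m k =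
        ∑ l : Fin 2 → Fin d, (∏ i, h (l i)) *
          (-(partialDeriv 2 ![l 0, l 1] (f k) θ₀) / m k) := by
      intro k
      rw [multilinear_apply_eq_sum, ← Finset.sum_neg_distrib, Finset.sum_div]
      refine Finset.sum_congr rfl fun l _ => ?_
      have : ![l 0, l 1] = l := by ext i; fin_cases i <;> rfl
      rw [this, partialDeriv]
      ring
    simp_rw [hterm]
    exact tendsto_finsetSum _ fun l _ => (hinfo (l 0) (l 1)).const_mul _
  rw [← sub_zero (-(1 / 2) * (h.ofLp ⬝ᵥ I₀.mulVec h.ofLp))]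
  have hmain := hquad.const_mul (-(1 / 2))
  -- the remainder
  set S : ℕ → ℝ := fun k => (d : ℝ) ^ 3 * D * (‖c k - θ₀‖ + ‖u k • h‖) * ‖h‖ ^ 2 with hS
  have hS0 : Tendsto S atTop (𝓝 0) := by
    have h1 : Tendsto (fun k => ‖c k - θ₀‖) atTop (𝓝 0) := tendsto_iff_norm_sub_tendsto_zero.1 hc
    have h2 : Tendsto (fun k => ‖u k • h‖) atTop (𝓝 0) := by
      simpa using (hu0.smul_const h).norm
    simpa using ((h1.add h2).const_mul ((d : ℝ) ^ 3 * D)).mul_const (‖h‖ ^ 2)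
  have hdiffto : Tendsto (fun k => -(1 / 2) * (-(iteratedFDeriv ℝ 2 (f k) θ₀ fun _ => h) / m k) -
      (K k : ℝ) * (f k (c k + u k • h) - f k (c k))) atTop (𝓝 0) := by
    refine squeeze_zero_norm' ?_ hS0
    filter_upwards [hm, hdiff, hthird, hc.eventually (Metric.ball_mem_nhds θ₀ hr), hgrad,
      hθ.eventually (Metric.ball_mem_nhds θ₀ hr), hn.eventually_gt_atTop 0]
      with k hmk hdk htk hcb hgk hθb hnk
    have hmk' : (0 : ℝ) < m k := by exact_mod_cast hmk
    obtain ⟨t, ht, hexp⟩ := exists_sub_eq_half_iteratedFDeriv_two (convex_ball θ₀ r)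
      (fun x hx i hi => hdk x hx i (by omega)) hcb hθb hgk
    rw [add_sub_cancel_left] at hexp
    have hξ : c k + t • u k • h ∈ Metric.ball θ₀ r := by
      have := (convex_ball θ₀ r).add_smul_sub_mem hcb hθb (Set.Ioo_subset_Icc_self ht)
      rwa [add_sub_cancel_left] at this
    have hlip := norm_iteratedFDeriv_two_sub_le (convex_ball θ₀ r)
      (mul_nonneg hD hmk'.le) (fun x hx => hdk x hx 2 (by norm_num)) htk
      (Metric.mem_ball_self hr) hξ
    set T₁ := iteratedFDeriv ℝ 2 (f k) (c k + t • u k • h)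
    set T₀ := iteratedFDeriv ℝ 2 (f k) θ₀
    -- The local scale is chosen so that `K` copies of the squared increment give exactly the
    -- normalization `1 / m` of the information.
    have hK : (K k : ℝ) * u k ^ 2 = (m k : ℝ)⁻¹ := by
      have hnk' : (0 : ℝ) < (m k : ℝ) * K k := by exact_mod_cast hnk
      have hKk : (0 : ℝ) < K k := pos_of_mul_pos_right hnk' hmk'.le
      simp only [hu]
      push_cast
      rw [inv_pow, Real.sq_sqrt hnk'.le]
      field_simp
    have hscale : (T₁ fun _ => u k • h) = u k ^ 2 * T₁ fun _ => h := by
      rw [ContinuousMultilinearMap.map_smul_univ]; simp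
    have heq : -(1 / 2) * (-(T₀ fun _ => h) / m k) -
        (K k : ℝ) * (f k (c k + u k • h) - f k (c k)) =
        -(1 / 2) * (m k : ℝ)⁻¹ * ((T₁ - T₀) fun _ => h) := by
      rw [hexp, hscale, sub_apply]
      linear_combination (-(1 / 2) * (T₁ fun _ => h)) * hK
    have hop : |(T₁ - T₀) fun _ => h| ≤ ‖T₁ - T₀‖ * ‖h‖ ^ 2 := by
      simpa using (T₁ - T₀).le_opNorm fun _ => h
    have hdist : ‖c k + t • u k • h - θ₀‖ ≤ ‖c k - θ₀‖ + ‖u k • h‖ := by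
      have h1 : c k + t • u k • h - θ₀ = (c k - θ₀) + t • u k • h := by abel
      rw [h1]
      refine (norm_add_le _ _).trans ?_
      gcongr
      rw [norm_smul t, Real.norm_eq_abs, abs_of_pos ht.1]
      exact mul_le_of_le_one_left (norm_nonneg _) ht.2.le
    rw [heq, Real.norm_eq_abs, abs_mul, abs_mul, abs_of_pos (inv_pos.2 hmk')]
    calc |(-(1 / 2) : ℝ)| * (m k : ℝ)⁻¹ * |(T₁ - T₀) fun _ => h|
        ≤ 1 * (m k : ℝ)⁻¹ * (((d : ℝ) ^ 3 * (D * m k) * (‖c k - θ₀‖ + ‖u k • h‖)) * ‖h‖ ^ 2) := by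
          gcongr
          · rw [abs_neg]; norm_num
          · exact hop.trans (by gcongr; exact hlip.trans (by gcongr))
      _ = S k := by simp only [hS]; field_simp
  exact (hmain.sub hdiffto).congr fun k => sub_sub_cancel _ _

end LogLikelihoodExpansion

/-! ### Consistency of the maximizer and the pathwise limit -/

section MaximumLikelihood

variable {d : ℕ}

lemma exists_le_sub_of_unique_max {Θ : Set (Par d)} (hΘ : IsCompact Θ) {θ₀ : Par d}
    {L : Par d → ℝ} (hL : ContinuousOn L Θ) (hmax : ∀ θ ∈ Θ, θ ≠ θ₀ → L θ < L θ₀) {r : ℝ}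
    (hr : 0 < r) : ∃ κ > 0, ∀ θ ∈ Θ, r ≤ ‖θ - θ₀‖ → L θ ≤ L θ₀ - κ := by
  have hF : IsCompact (Θ ∩ {θ | r ≤ ‖θ - θ₀‖}) :=
    hΘ.inter_right (isClosed_le continuous_const (by fun_prop))
  rcases (Θ ∩ {θ | r ≤ ‖θ - θ₀‖}).eq_empty_or_nonempty with he | hne
  · refine ⟨1, one_pos, fun θ hθ hθr => ?_⟩
    have : θ ∈ Θ ∩ {θ | r ≤ ‖θ - θ₀‖} := ⟨hθ, hθr⟩
    rw [he] at this
    exact absurd this (Set.notMem_empty θ)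
  · obtain ⟨θ₁, hθ₁, hm⟩ := hF.exists_isMaxOn hne (hL.mono Set.inter_subset_left)
    have hne' : θ₁ ≠ θ₀ := by
      rintro rfl
      have := hθ₁.2
      simp only [Set.mem_ofPred_eq, sub_self, norm_zero] at this
      linarith
    refine ⟨L θ₀ - L θ₁, sub_pos.2 (hmax θ₁ hθ₁.1 hne'), fun θ hθ hθr => ?_⟩
    have := isMaxOn_iff.1 hm θ ⟨hθ, hθr⟩
    linarith

/-- A uniform error below `κ / 3` at `θ`, `θ₀` and `c k` leaves `κ / 3` of the gap `κ`. The same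
comparison excludes `c k` from the far region, so it also yields consistency. -/
lemma eventually_separation {Θ : Set (Par d)} (hΘ : IsCompact Θ) {θ₀ : Par d} (hθ₀ : θ₀ ∈ Θ)
    {L : Par d → ℝ} (hL : ContinuousOn L Θ) (hmax : ∀ θ ∈ Θ, θ ≠ θ₀ → L θ < L θ₀)
    {f : ℕ → Par d → ℝ} {c : ℕ → Par d} {m : ℕ → ℕ} (hm : ∀ᶠ k in atTop, 0 < m k)
    (hunif : TendstoUniformlyOn (fun k θ => f k θ / m k) L atTop Θ)
    (hc : ∀ᶠ k in atTop, c k ∈ Θ ∧ f k θ₀ ≤ f k (c k)) {r : ℝ} (hr : 0 < r) :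
    ∃ κ > 0, ∀ᶠ k in atTop, ‖c k - θ₀‖ < r ∧
      ∀ θ ∈ Θ, r ≤ ‖θ - θ₀‖ → f k θ - f k (c k) ≤ -κ * m k := by
  obtain ⟨κ, hκ, hsep⟩ := exists_le_sub_of_unique_max hΘ hL hmax hr
  refine ⟨κ / 3, by positivity, ?_⟩
  filter_upwards [Metric.tendstoUniformlyOn_iff.1 hunif (κ / 3) (by positivity), hc, hm]
    with k hk hck hmk
  have hmk' : (0 : ℝ) < m k := by exact_mod_cast hmk
  have h0 := hk θ₀ hθ₀
  have h1 := hk _ hck.1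
  have h2 : f k θ₀ / m k ≤ f k (c k) / m k := by gcongr; exact hck.2
  rw [Real.dist_eq, abs_lt] at h0 h1
  constructor
  · by_contra! hcon
    have := hsep _ hck.1 hcon
    linarith [h0.1, h0.2, h1.1, h1.2]
  · intro θ hθ hθr
    have h3 := hk θ hθ
    have h4 := hsep θ hθ hθr
    rw [Real.dist_eq, abs_lt] at h3
    have h5 : (f k θ - f k (c k)) / m k ≤ -(κ / 3) := by
      rw [sub_div]; linarith [h0.1, h0.2, h3.1, h3.2]
    rwa [div_le_iff₀ hmk'] at h5

/-- Pathwise Bernstein-von Mises theorem, in `L¹` for unnormalized densities: a quasi-likelihood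
`Q k` that is asymptotically equivalent to the power `ℓ k ^ K k` of a likelihood, centred at a
maximizer `c k`. -/
lemma tendsto_lintegral_localDensity_quasiLik {Θ : Set (Par d)} (hΘ : IsCompact Θ) {θ₀ : Par d}
    (hθ₀ : θ₀ ∈ interior Θ) {ϖ : Par d → ℝ} (hϖ : ContinuousOn ϖ Θ) (hϖ₀ : 0 < ϖ θ₀)
    {I₀ : Matrix (Fin d) (Fin d) ℝ}
    (hI₀ : Integrable fun h : Par d => Real.exp (-(1 / 2) * (h.ofLp ⬝ᵥ I₀.mulVec h.ofLp)))
    {L : Par d → ℝ} (hL : ContinuousOn L Θ) (hmax : ∀ θ ∈ Θ, θ ≠ θ₀ → L θ < L θ₀)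
    {m K : ℕ → ℕ} (hm : Tendsto m atTop atTop) (hK : Tendsto K atTop atTop)
    {ℓ Q : ℕ → Par d → ℝ} {c : ℕ → Par d} (hQ : ∀ k, Measurable (Q k))
    (hpos : ∀ᶠ k in atTop, ∀ θ ∈ Θ, 0 < ℓ k θ)
    (hunif : TendstoUniformlyOn (fun k θ => Real.log (ℓ k θ) / m k) L atTop Θ)
    (hmle : ∀ᶠ k in atTop, c k ∈ Θ ∧ (∀ θ ∈ Θ, ℓ k θ ≤ ℓ k (c k)) ∧
      HasGradientAt (fun θ => Real.log (ℓ k θ)) 0 (c k))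
    {r D c₁ : ℝ} (hr : 0 < r) (hD : 0 ≤ D) (hc₁ : 0 < c₁)
    (hdiff : ∀ᶠ k in atTop, ∀ θ ∈ Metric.ball θ₀ r, ∀ i < 3,
      DifferentiableAt ℝ (iteratedFDeriv ℝ i fun θ => Real.log (ℓ k θ)) θ)
    (hthird : ∀ᶠ k in atTop, ∀ θ ∈ Metric.ball θ₀ r, ∀ l : Fin 3 → Fin d,
      |partialDeriv 3 l (fun θ => Real.log (ℓ k θ)) θ| ≤ D * m k)
    (hcurv : ∀ᶠ k in atTop, ∀ θ ∈ Metric.ball θ₀ r, ∀ v : Par d,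
      c₁ * ‖v‖ ^ 2 ≤ -(iteratedFDeriv ℝ 2 (fun θ => Real.log (ℓ k θ)) θ fun _ => v) / m k)
    (hinfo : ∀ i j, Tendsto (fun k =>
      -(partialDeriv 2 ![i, j] (fun θ => Real.log (ℓ k θ)) θ₀) / m k) atTop (𝓝 (I₀ i j)))
    {η : ℕ → ℝ} (hη : Tendsto η atTop (𝓝 0))
    (hQℓ : ∀ᶠ k in atTop, ∀ᵐ θ ∂volume.restrict Θ, |Q k θ - ℓ k θ ^ K k| ≤ η k * ℓ k θ ^ K k) :
    Tendsto (fun k => ∫⁻ h : Par d, ENNReal.ofReal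
      |(|ℓ k (c k) ^ K k| * ϖ θ₀)⁻¹ * localDensity Θ ϖ (Q k) (m k * K k) (c k) h -
        Real.exp (-(1 / 2) * (h.ofLp ⬝ᵥ I₀.mulVec h.ofLp))|) atTop (𝓝 0) := by
  have hθ₀' := interior_subset hθ₀
  have hm0 : ∀ᶠ k in atTop, 0 < m k := hm.eventually_gt_atTop 0
  have hn : Tendsto (fun k => m k * K k) atTop atTop := hm.atTop_mul_atTop₀ hK
  have hcmax : ∀ᶠ k in atTop, c k ∈ Θ ∧ Real.log (ℓ k θ₀) ≤ Real.log (ℓ k (c k)) := by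
    filter_upwards [hpos, hmle] with k hk hmk
    exact ⟨hmk.1, Real.log_le_log (hk _ hθ₀') (hmk.2.1 _ hθ₀')⟩
  have hc : Tendsto c atTop (𝓝 θ₀) := by
    rw [tendsto_iff_norm_sub_tendsto_zero, Metric.tendsto_nhds]
    intro ε hε
    obtain ⟨κ, -, h⟩ := eventually_separation hΘ hθ₀' hL hmax hm0 hunif hcmax hε
    filter_upwards [h] with k hk
    simpa using hk.1
  obtain ⟨κ, hκ, hsep⟩ := eventually_separation hΘ hθ₀' hL hmax hm0 hunif hcmax hr
  obtain ⟨a, ha, hΛ⟩ := mul_sub_le_of_curvature_of_separation (K := K) hΘ hr hc₁ hκ hm0 hdiff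
    hcurv hc (hmle.mono fun _ h => h.1) (hmle.mono fun _ h => h.2.2) (hsep.mono fun _ h => h.2)
  have hlim := tendsto_mul_sub_local hr hD hm0 hn hdiff hthird hinfo hc
    (hmle.mono fun _ h => h.2.2)
  have hmeas : Measurable fun h : Par d => h.ofLp ⬝ᵥ I₀.mulVec h.ofLp := by
    simp only [dotProduct, Matrix.mulVec]
    fun_prop
  -- Dividing by `ℓ(c)^K` makes the log quasi-likelihood vanish at the centre, so that `exp Λ =
  -- (ℓ(θ)/ℓ(c))^K`.
  have hfin := tendsto_lintegral_localDensity_sub (n := fun k => m k * K k)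
    (Λ := fun k θ => (K k : ℝ) * (Real.log (ℓ k θ) - Real.log (ℓ k (c k))))
    (R := fun k θ => (|ℓ k (c k) ^ K k|)⁻¹ * Q k θ) hΘ hθ₀ hϖ hϖ₀ hn hc
    (fun k => (hQ k).const_mul _) hmeas hI₀ ha hΛ hlim hη ?_
  · refine hfin.congr fun k => lintegral_congr fun h => ?_
    rw [localDensity, localDensity, mul_inv]
    congr 3
    ring
  · filter_upwards [hQℓ, hpos, hmle] with k hk hpk hmk
    filter_upwards [hk, ae_restrict_mem hΘ.isClosed.measurableSet] with θ hθ hθm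
    have h1 := hpk θ hθm
    have h2 := hpk _ hmk.1
    have h3 : 0 < ℓ k (c k) ^ K k := by positivity
    have h4 : Real.exp ((K k : ℝ) * (Real.log (ℓ k θ) - Real.log (ℓ k (c k)))) =
        (ℓ k (c k) ^ K k)⁻¹ * ℓ k θ ^ K k := by
      rw [← Real.log_div h1.ne' h2.ne', Real.exp_nat_mul, Real.exp_log (by positivity), div_pow]
      ring
    rw [h4, abs_of_pos h3, ← mul_sub, abs_mul, abs_of_pos (inv_pos.2 h3)]
    calc (ℓ k (c k) ^ K k)⁻¹ * |Q k θ - ℓ k θ ^ K k|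
        ≤ (ℓ k (c k) ^ K k)⁻¹ * (η k * ℓ k θ ^ K k) := by gcongr
      _ = _ := by ring

end MaximumLikelihood

/-! ### Joint measurability and stationarity of the hidden Markov model -/

namespace HMMFamily

variable {d S : ℕ} {𝒴 : Type*} [MeasurableSpace 𝒴] {μ : Measure 𝒴} {Θ : Set (Par d)}
  (H : HMMFamily S μ Θ)

lemma measurable_pathProb {n : ℕ} {ν : Par d → Fin S → ℝ} (hν : ∀ a, Measurable fun θ => ν θ a)
    (x : Fin n → Fin S) : Measurable fun θ => H.pathProb θ (ν θ) x := by
  unfold pathProb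
  refine Finset.measurable_prod _ fun t _ => ?_
  split_ifs
  · exact hν _
  · exact H.measurable_trans _ _

lemma measurable_prod_emis {n : ℕ} (x : Fin n → Fin S) :
    Measurable fun p : Par d × (Fin n → 𝒴) => ∏ t, H.emis p.1 (p.2 t) (x t) :=
  Finset.measurable_prod _ fun t _ => (H.measurable_emis (x t)).comp
    (measurable_fst.prodMk ((measurable_pi_apply t).comp measurable_snd))

lemma measurable_likFrom {n : ℕ} {ν : Par d → Fin S → ℝ} (hν : ∀ a, Measurable fun θ => ν θ a) :
    Measurable fun p : Par d × (Fin n → 𝒴) => H.likFrom p.1 (ν p.1) p.2 := by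
  unfold likFrom
  exact Finset.measurable_sum _ fun x _ =>
    ((H.measurable_pathProb hν x).comp measurable_fst).mul (H.measurable_prod_emis x)

lemma measurable_lik {n : ℕ} : Measurable fun p : Par d × (Fin n → 𝒴) => H.lik p.1 p.2 :=
  H.measurable_likFrom H.measurable_init

lemma measurable_predFilter {n : ℕ} (a : Fin S) :
    Measurable fun p : Par d × (Fin n → 𝒴) => H.predFilter p.1 p.2 a := by
  unfold predFilter
  refine Measurable.div (Finset.measurable_sum _ fun x _ => ?_) H.measurable_lik
  split_ifs
  · exact ((H.measurable_pathProb H.measurable_init x).comp measurable_fst).mul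
      (H.measurable_prod_emis fun t => x t.castSucc)
  · exact measurable_const

lemma measurable_condLik {n n' : ℕ} :
    Measurable fun p : Par d × (Fin n → 𝒴) × (Fin n' → 𝒴) => H.condLik p.1 p.2.1 p.2.2 := by
  unfold condLik
  refine Finset.measurable_sum _ fun a _ => ?_
  have h1 : Measurable fun p : Par d × (Fin n → 𝒴) => H.likFrom p.1 (Pi.single a 1) p.2 :=
    H.measurable_likFrom (ν := fun _ => Pi.single a 1) fun b => measurable_const
  have h2 : Measurable fun p : Par d × (Fin n → 𝒴) × (Fin n' → 𝒴) => (p.1, p.2.1) := by fun_prop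
  have h3 : Measurable fun p : Par d × (Fin n → 𝒴) × (Fin n' → 𝒴) => (p.1, p.2.2) := by fun_prop
  have h4 := h1.comp h2
  have h5 := (H.measurable_predFilter (n := n') a).comp h3
  exact h4.mul h5

lemma pathProb_succ (θ : Par d) (ν : Fin S → ℝ) {n : ℕ} (x : Fin (n + 1) → Fin S) :
    H.pathProb θ ν x = ν (x 0) * ∏ i : Fin n, H.trans θ (x i.castSucc) (x i.succ) := by
  rw [pathProb, Fin.prod_univ_succ]
  rfl

lemma pathProb_cons (θ : Par d) (ν : Fin S → ℝ) {n : ℕ} (a : Fin S) (x : Fin n → Fin S) :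
    H.pathProb θ ν (Fin.cons a x : Fin (n + 1) → Fin S) =
      ν a * H.pathProb θ (H.trans θ a) x := by
  rw [pathProb_succ, Fin.cons_zero]
  cases n with
  | zero => simp [pathProb]
  | succ n =>
    rw [pathProb_succ, Fin.prod_univ_succ]
    simp only [Fin.cons_succ, Fin.castSucc_zero, Fin.cons_zero, Fin.castSucc_succ]

/-- Conditioning on the first state: the remaining chain starts from the corresponding row of the
transition matrix. -/
lemma likFrom_cons (θ : Par d) (ν : Fin S → ℝ) {n : ℕ} (y₀ : 𝒴) (y : Fin n → 𝒴) :
    H.likFrom θ ν (Fin.cons y₀ y : Fin (n + 1) → 𝒴) =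
      ∑ a, ν a * H.emis θ y₀ a * H.likFrom θ (H.trans θ a) y := by
  rw [likFrom, ← (Fin.consEquiv fun _ : Fin (n + 1) => Fin S).sum_comp, Fintype.sum_prod_type]
  refine Finset.sum_congr rfl fun a _ => ?_
  rw [likFrom, Finset.mul_sum]
  refine Finset.sum_congr rfl fun x _ => ?_
  rw [Fin.prod_univ_succ]
  simp only [Fin.consEquiv, Equiv.coe_fn_mk, Fin.cons_zero, Fin.cons_succ]
  rw [pathProb_cons]
  ring

/-- Linearity in the initial law. The length must be positive: the empty path has weight 1 whatever
the initial law is. -/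
lemma likFrom_sum {ι : Type*} (s : Finset ι) (w : ι → ℝ) (θ : Par d) (ν : ι → Fin S → ℝ) {n : ℕ}
    (y : Fin (n + 1) → 𝒴) :
    H.likFrom θ (fun b => ∑ i ∈ s, w i * ν i b) y = ∑ i ∈ s, w i * H.likFrom θ (ν i) y := by
  simp only [likFrom, pathProb_succ, Finset.mul_sum, Finset.sum_mul]
  rw [Finset.sum_comm]
  refine Finset.sum_congr rfl fun i _ => Finset.sum_congr rfl fun x _ => ?_
  ring

lemma sum_init_mul_likFrom_trans {θ : Par d} (hθ : θ ∈ Θ) {n : ℕ} (y : Fin n → 𝒴) :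
    ∑ a, H.init θ a * H.likFrom θ (H.trans θ a) y = H.lik θ y := by
  cases n with
  | zero => simp [lik, likFrom, pathProb, H.init_sum θ hθ]
  | succ n =>
    refine (H.likFrom_sum Finset.univ (H.init θ) θ (fun a => H.trans θ a) y).symm.trans ?_
    rw [lik]
    congr 1
    ext b
    exact H.stationary θ hθ b

lemma likFrom_nonneg {θ : Par d} (hθ : θ ∈ Θ) {ν : Fin S → ℝ} (hν : ∀ a, 0 ≤ ν a) {n : ℕ}
    (y : Fin n → 𝒴) : 0 ≤ H.likFrom θ ν y := by
  refine Finset.sum_nonneg fun x _ => mul_nonneg (Finset.prod_nonneg fun t _ => ?_)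
    (Finset.prod_nonneg fun t _ => H.emis_nonneg θ hθ _ _)
  split_ifs
  · exact hν _
  · exact H.trans_nonneg θ hθ _ _

/-- Integrating out the first observation removes its emission density, and stationarity turns the
law of the second state back into `r_θ`. -/
lemma lintegral_lik_cons {θ : Par d} (hθ : θ ∈ Θ) {n : ℕ} (y : Fin n → 𝒴) :
    ∫⁻ y₀, ENNReal.ofReal (H.lik θ (Fin.cons y₀ y : Fin (n + 1) → 𝒴)) ∂μ =
      ENNReal.ofReal (H.lik θ y) := by
  have hm : ∀ a, Measurable fun y₀ => H.emis θ y₀ a := fun a =>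
    (H.measurable_emis a).comp measurable_prodMk_left
  have hc : ∀ a, 0 ≤ H.init θ a * H.likFrom θ (H.trans θ a) y := fun a =>
    mul_nonneg (H.init_nonneg θ hθ a) (H.likFrom_nonneg hθ (H.trans_nonneg θ hθ a) y)
  have h1 : ∀ y₀, ENNReal.ofReal (H.lik θ (Fin.cons y₀ y : Fin (n + 1) → 𝒴)) =
      ∑ a, ENNReal.ofReal (H.init θ a * H.likFrom θ (H.trans θ a) y) *
        ENNReal.ofReal (H.emis θ y₀ a) := by
    intro y₀
    rw [lik, likFrom_cons, ENNReal.ofReal_sum_of_nonneg]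
    · refine Finset.sum_congr rfl fun a _ => ?_
      rw [← ENNReal.ofReal_mul (hc a)]
      congr 1; ring
    · intro a _
      have := mul_nonneg (hc a) (H.emis_nonneg θ hθ y₀ a)
      linarith
  simp_rw [h1]
  rw [lintegral_finsetSum _ fun a _ => by have := hm a; fun_prop]
  have h2 : ∀ a, ∫⁻ y₀, ENNReal.ofReal (H.init θ a * H.likFrom θ (H.trans θ a) y) *
      ENNReal.ofReal (H.emis θ y₀ a) ∂μ =
      ENNReal.ofReal (H.init θ a * H.likFrom θ (H.trans θ a) y) := by
    intro a
    rw [lintegral_const_mul _ (by have := hm a; fun_prop), H.emis_lintegral θ hθ, mul_one]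
  simp_rw [h2]
  rw [← ENNReal.ofReal_sum_of_nonneg fun a _ => hc a, sum_init_mul_likFrom_trans H hθ]

lemma map_tail_withDensity_lik [SigmaFinite μ] {θ : Par d} (hθ : θ ∈ Θ) (n : ℕ) :
    ((Measure.pi fun _ : Fin (n + 1) => μ).withDensity fun y => ENNReal.ofReal (H.lik θ y)).map
      (fun y (i : Fin n) => y i.succ) =
    (Measure.pi fun _ : Fin n => μ).withDensity fun y => ENNReal.ofReal (H.lik θ y) := by
  have hlik : ∀ k, Measurable fun y : Fin k → 𝒴 => ENNReal.ofReal (H.lik θ y) := fun k =>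
    (H.measurable_lik.comp measurable_prodMk_left).ennreal_ofReal
  have htail : Measurable fun (y : Fin (n + 1) → 𝒴) (i : Fin n) => y i.succ := by fun_prop
  ext s hs
  rw [Measure.map_apply htail hs, withDensity_apply _ (htail hs), withDensity_apply _ hs,
    ← lintegral_indicator (htail hs), ← lintegral_indicator hs]
  have hmp := (measurePreserving_piFinSuccAbove (fun _ : Fin (n + 1) => μ) 0).symm
  rw [← hmp.lintegral_comp ((hlik (n + 1)).indicator (htail hs)), lintegral_prod_symm]
  · refine lintegral_congr fun y => ?_
    by_cases hy : y ∈ s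
    · rw [Set.indicator_of_mem hy, ← lintegral_lik_cons H hθ y]
      refine lintegral_congr fun y₀ => ?_
      rw [Set.indicator_of_mem]
      · congr 2
        exact Fin.insertNth_zero' y₀ y
      · exact hy
    · rw [Set.indicator_of_notMem hy, ← lintegral_zero (μ := μ)]
      refine lintegral_congr fun y₀ => ?_
      rw [Set.indicator_of_notMem]
      exact hy
  · exact (((hlik (n + 1)).indicator (htail hs)).comp (MeasurableEquiv.measurable _)).aemeasurable

/-- The observations are stationary. -/
lemma IsObservation.map_shift [SigmaFinite μ] {H : HMMFamily S μ Θ} {Ω : Type*} [MeasurableSpace Ω]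
    {P : Measure Ω} {Y : ℕ → Ω → 𝒴} {θ : Par d} (hY : H.IsObservation θ P Y) (hθ : θ ∈ Θ)
    (s n : ℕ) :
    P.map (fun ω (i : Fin n) => Y (s + i + 1) ω) = P.map (fun ω (i : Fin n) => Y (i + 1) ω) := by
  have hmeas : ∀ s k : ℕ, Measurable fun ω (i : Fin k) => Y (s + i + 1) ω := fun s k =>
    measurable_pi_lambda _ fun i => hY.1 _
  -- A window shifted by `s + 1` is the tail of a window one longer shifted by `s`, so the length
  -- has to vary in the induction.
  induction s generalizing n with
  | zero => simp
  | succ s ih =>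
    have h1 : (fun ω (i : Fin n) => Y (s + 1 + i + 1) ω) =
        (fun (y : Fin (n + 1) → 𝒴) (i : Fin n) => y i.succ) ∘
          fun ω (i : Fin (n + 1)) => Y (s + i + 1) ω := by
      ext ω i
      simp only [Function.comp_apply, Fin.val_succ]
      congr 1; omega
    have htail : Measurable fun (y : Fin (n + 1) → 𝒴) (i : Fin n) => y i.succ := by fun_prop
    rw [h1, ← Measure.map_map htail (hmeas s (n + 1)), ih (n + 1), hY.2 (n + 1),
      map_tail_withDensity_lik H hθ, hY.2 n]

end HMMFamily

/-! ### Conditional against marginal block likelihood -/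

lemma abs_pow_sub_pow_le_of_abs_sub_le_mul {q l δ : ℝ} (hl : 0 ≤ l) (hδ : 0 ≤ δ) (h : |q - l| ≤ δ * l) (K : ℕ) :
    |q ^ K - l ^ K| ≤ ((1 + δ) ^ K - 1) * l ^ K := by
  induction K with
  | zero => simp
  | succ K ih =>
    have h1 : q ^ (K + 1) - l ^ (K + 1) = q * (q ^ K - l ^ K) + l ^ K * (q - l) := by ring
    have h2 : |q| ≤ (1 + δ) * l := by
      calc |q| = |(q - l) + l| := by ring_nf
        _ ≤ |q - l| + |l| := abs_add_le _ _
        _ ≤ δ * l + l := by rw [abs_of_nonneg hl]; gcongr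
        _ = _ := by ring
    rw [h1]
    calc |q * (q ^ K - l ^ K) + l ^ K * (q - l)|
        ≤ |q| * |q ^ K - l ^ K| + l ^ K * |q - l| := by
          refine (abs_add_le _ _).trans (le_of_eq ?_)
          rw [abs_mul, abs_mul, abs_of_nonneg (pow_nonneg hl K)]
      _ ≤ ((1 + δ) * l) * (((1 + δ) ^ K - 1) * l ^ K) + l ^ K * (δ * l) := by gcongr
      _ = _ := by ring

namespace HMMFamily

variable {d S : ℕ} {𝒴 : Type*} [MeasurableSpace 𝒴] {μ : Measure 𝒴} {Θ : Set (Par d)}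
  (H : HMMFamily S μ Θ)

/-- By stationarity `r_θ(a)` is an average of the transition probabilities into `a`, each at least
`ε`. -/
lemma minTrans_le_init {θ : Par d} (hθ : θ ∈ Θ) (a : Fin S) : minTrans H ≤ H.init θ a := by
  have hle : ∀ b, minTrans H ≤ H.trans θ b a := fun b => by
    refine csInf_le ⟨0, ?_⟩ ⟨θ, hθ, b, a, rfl⟩
    rintro _ ⟨θ', hθ', b', a', rfl⟩
    exact H.trans_nonneg θ' hθ' b' a'
  rw [← H.stationary θ hθ a]
  calc minTrans H = ∑ b, H.init θ b * minTrans H := by rw [← Finset.sum_mul, H.init_sum θ hθ, one_mul]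
    _ ≤ _ := Finset.sum_le_sum fun b _ =>
      mul_le_mul_of_nonneg_left (hle b) (H.init_nonneg θ hθ b)

lemma likFrom_eq_sum_single (θ : Par d) (ν : Fin S → ℝ) {n : ℕ} (y : Fin (n + 1) → 𝒴) :
    H.likFrom θ ν y = ∑ a, ν a * H.likFrom θ (Pi.single a 1) y := by
  rw [← likFrom_sum H Finset.univ ν θ (fun a => Pi.single a 1) y]
  congr 1
  ext b
  simp [Pi.single_apply]

/-- The one-block conditional likelihood is close to the block likelihood when the prediction
filter is close to the stationary distribution. -/
lemma abs_condLik_sub_lik_le {θ : Par d} (hθ : θ ∈ Θ) (hε : 0 < minTrans H) {n n' : ℕ}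
    (hn : 0 < n) (y : Fin n → 𝒴) (y' : Fin n' → 𝒴) {τ : ℝ}
    (hτ : tvVec (H.predFilter θ y') (H.init θ) ≤ τ) :
    |H.condLik θ y y' - H.lik θ y| ≤ 2 * τ / minTrans H * H.lik θ y := by
  obtain ⟨n, rfl⟩ := Nat.exists_eq_succ_of_ne_zero hn.ne'
  have hp : ∀ a, 0 ≤ H.likFrom θ (Pi.single a 1) y := fun a =>
    H.likFrom_nonneg hθ (fun b => by rw [Pi.single_apply]; split_ifs <;> norm_num) y
  rw [lik, likFrom_eq_sum_single H θ (H.init θ), condLik, ← Finset.sum_sub_distrib, Finset.mul_sum]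
  refine (Finset.abs_sum_le_sum_abs _ _).trans (Finset.sum_le_sum fun a _ => ?_)
  have h1 : |H.predFilter θ y' a - H.init θ a| ≤ 2 * τ := by
    have h2 := Finset.single_le_sum (f := fun a => |H.predFilter θ y' a - H.init θ a|)
      (fun b _ => abs_nonneg _) (Finset.mem_univ a)
    unfold tvVec at hτ
    linarith
  have h3 : 0 ≤ 2 * τ := (abs_nonneg _).trans h1
  -- The lower bound `ε` on the stationary law turns the additive filter error into a relative one.
  have h4 : 2 * τ ≤ 2 * τ / minTrans H * H.init θ a := by
    rw [div_mul_eq_mul_div, le_div_iff₀ hε]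
    exact mul_le_mul_of_nonneg_left (H.minTrans_le_init hθ a) h3
  calc |H.likFrom θ (Pi.single a 1) y * H.predFilter θ y' a -
        H.init θ a * H.likFrom θ (Pi.single a 1) y|
      = H.likFrom θ (Pi.single a 1) y * |H.predFilter θ y' a - H.init θ a| := by
        rw [mul_comm (H.init θ a), ← mul_sub, abs_mul, abs_of_nonneg (hp a)]
    _ ≤ H.likFrom θ (Pi.single a 1) y * (2 * τ / minTrans H * H.init θ a) :=
        mul_le_mul_of_nonneg_left (h1.trans h4) (hp a)
    _ = _ := by ring

end HMMFamily

section Mixing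

variable {d S : ℕ} {𝒴 : Type*} [MeasurableSpace 𝒴] {μ : Measure 𝒴} {Θ : Set (Par d)}
  {H : HMMFamily S μ Θ} {θ₀ : Par d} {Ω : Type*} [MeasurableSpace Ω] {P : Measure Ω}
  {Y : ℕ → Ω → 𝒴}

lemma measurable_block (hY : ∀ t, Measurable (Y t)) (m j : ℕ) : Measurable (block Y m j) :=
  measurable_pi_lambda _ fun _ => hY _

/-- The assumption has a null set of paths for each `θ`, whereas a posterior integrates over `θ` on
one path. Joint measurability and Fubini exchange the two quantifiers. -/
lemma FilterMixing.ae_tvVec_le [SFinite P] (hΘ : MeasurableSet Θ) (hY : ∀ t, Measurable (Y t))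
    {M : ℝ} (hM : FilterMixing H θ₀ P Y M) :
    ∀ᵐ ω ∂P, ∀ᵐ θ ∂volume.restrict Θ, ∀ m : ℕ, 2 ≤ m →
      tvVec (H.predFilter θ (block Y m 1 ω)) (H.init θ) ≤ S * mixCoef H M ^ (m - 2) := by
  have hmeas : MeasurableSet {p : Par d × Ω | ∀ m : ℕ, 2 ≤ m →
      tvVec (H.predFilter p.1 (block Y m 1 p.2)) (H.init p.1) ≤ S * mixCoef H M ^ (m - 2)} := by
    simp only [Set.ofPred_forall]
    refine MeasurableSet.iInter fun m => MeasurableSet.iInter fun _ =>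
      measurableSet_le ?_ measurable_const
    unfold tvVec
    refine Measurable.div_const (Finset.measurable_sum _ fun a _ => ?_) _
    have h1 := (H.measurable_predFilter (n := m) a).comp
      (measurable_fst.prodMk ((measurable_block hY m 1).comp measurable_snd) :
        Measurable fun p : Par d × Ω => (p.1, block Y m 1 p.2))
    exact (h1.sub ((H.measurable_init a).comp measurable_fst)).abs
  rw [← Measure.ae_ae_comm (p := fun (θ : Par d) ω => ∀ m : ℕ, 2 ≤ m →
      tvVec (H.predFilter θ (block Y m 1 ω)) (H.init θ) ≤ S * mixCoef H M ^ (m - 2)) hmeas]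
  filter_upwards [ae_restrict_mem hΘ] with θ hθ
  filter_upwards [hM.filter_conv θ hθ] with ω hω m hm
  exact (hω m hm).1.trans (hω m hm).2

lemma mixCoef_pos (H : HMMFamily S μ Θ) (M : ℝ) : 0 < mixCoef H M := Real.exp_pos _

/-- From `(1 + x)^K ≤ exp(K x)`, where `K x` is a constant multiple of `K ρ^m`; the shift in the
exponent costs the factor `ρ⁻²`. -/
lemma tendsto_mixing_error (H : HMMFamily S μ Θ) {M : ℝ} {K : ℕ → ℕ}
    (hK : (fun m => (K m : ℝ)) =o[atTop] (fun m : ℕ => (mixCoef H M ^ m)⁻¹)) (hε : 0 < minTrans H) :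
    Tendsto (fun m => (1 + 2 * (S * mixCoef H M ^ (m - 2)) / minTrans H) ^ K m - 1) atTop (𝓝 0) := by
  have hρ := mixCoef_pos H M
  have h1 : Tendsto (fun m => (K m : ℝ) * mixCoef H M ^ m) atTop (𝓝 0) := by
    refine hK.tendsto_div_nhds_zero.congr fun m => ?_
    rw [div_inv_eq_mul]
  have h2 : Tendsto (fun m => Real.exp (2 * S / minTrans H * (mixCoef H M ^ 2)⁻¹ *
      ((K m : ℝ) * mixCoef H M ^ m)) - 1) atTop (𝓝 0) := by
    have := (Real.continuous_exp.tendsto _).comp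
      (h1.const_mul (2 * S / minTrans H * (mixCoef H M ^ 2)⁻¹))
    simpa using this.sub_const 1
  refine tendsto_of_tendsto_of_tendsto_of_le_of_le' tendsto_const_nhds h2 ?_ ?_
  · refine Eventually.of_forall fun m => ?_
    rw [sub_nonneg]
    exact one_le_pow₀ (by rw [le_add_iff_nonneg_right]; positivity)
  · filter_upwards [eventually_ge_atTop 2] with m hm
    gcongr
    have h3 : 1 + 2 * (S * mixCoef H M ^ (m - 2)) / minTrans H ≤
        Real.exp (2 * (S * mixCoef H M ^ (m - 2)) / minTrans H) := by
      rw [add_comm]; exact Real.add_one_le_exp _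
    refine (pow_le_pow_left₀ (by positivity) h3 _).trans (le_of_eq ?_)
    rw [← Real.exp_nat_mul]
    congr 1
    have h4 : mixCoef H M ^ m = mixCoef H M ^ (m - 2) * mixCoef H M ^ 2 := by
      rw [← pow_add]; congr 1; omega
    rw [h4]
    field_simp

lemma FilterMixing.ae_condLik_pow_close [SFinite P] (hΘ : MeasurableSet Θ)
    (hY : ∀ t, Measurable (Y t)) {M : ℝ} (hε : 0 < minTrans H) (hM : FilterMixing H θ₀ P Y M)
    (K : ℕ → ℕ) :
    ∀ᵐ ω ∂P, ∀ᶠ m in atTop, ∀ᵐ θ ∂volume.restrict Θ,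
      |H.condLik θ (block Y m 2 ω) (block Y m 1 ω) ^ K m - H.lik θ (block Y m 2 ω) ^ K m| ≤
        ((1 + 2 * (S * mixCoef H M ^ (m - 2)) / minTrans H) ^ K m - 1) *
          H.lik θ (block Y m 2 ω) ^ K m := by
  have hρ := mixCoef_pos H M
  filter_upwards [hM.ae_tvVec_le hΘ hY] with ω hω
  filter_upwards [eventually_ge_atTop 2] with m hm
  filter_upwards [hω, ae_restrict_mem hΘ] with θ hθ hθm
  exact abs_pow_sub_pow_le_of_abs_sub_le_mul (H.likFrom_nonneg hθm (H.init_nonneg θ hθm) _) (by positivity)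
    (H.abs_condLik_sub_lik_le hθm hε (by omega) _ _ (hθ m hm)) _

end Mixing

/-! ### Laws of blocks and of consecutive pairs -/

section StationaryBlocks

variable {d S : ℕ} {𝒴 : Type*} [MeasurableSpace 𝒴] {μ : Measure 𝒴} [SigmaFinite μ]
  {Θ : Set (Par d)} {H : HMMFamily S μ Θ} {θ₀ : Par d} {Ω : Type*} [MeasurableSpace Ω]
  {P : Measure Ω} {Y : ℕ → Ω → 𝒴}

/-- All pairs of consecutive blocks have the same law. -/
lemma map_block_pair (hY : H.IsObservation θ₀ P Y) (hθ₀ : θ₀ ∈ Θ) (m : ℕ) {j : ℕ} (hj : 2 ≤ j) :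
    P.map (fun ω => (block Y m (j - 1) ω, block Y m j ω)) =
      P.map (fun ω => (block Y m 1 ω, block Y m 2 ω)) := by
  have hsplit : Measurable fun y : Fin (m + m) → 𝒴 =>
      ((fun i : Fin m => y (Fin.castAdd m i)), fun i : Fin m => y (Fin.natAdd m i)) := by fun_prop
  have key : ∀ s, P.map (fun ω => ((fun i : Fin m => Y (s + i + 1) ω),
      fun i : Fin m => Y (s + (m + i) + 1) ω)) =
      (P.map fun ω (i : Fin (m + m)) => Y (i + 1) ω).map fun y : Fin (m + m) → 𝒴 =>
      ((fun i : Fin m => y (Fin.castAdd m i)), fun i : Fin m => y (Fin.natAdd m i)) := by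
    intro s
    rw [← hY.map_shift hθ₀ s (m + m), Measure.map_map hsplit
      (measurable_pi_lambda _ fun i => hY.1 _)]
    rfl
  -- Blocks `j - 1` and `j` form one window of length `2m` that starts after `(j - 2) m`
  -- observations.
  have hblock : ∀ j, 2 ≤ j → (fun ω => (block Y m (j - 1) ω, block Y m j ω)) =
      fun ω => ((fun i : Fin m => Y ((j - 2) * m + i + 1) ω),
      fun i : Fin m => Y ((j - 2) * m + (m + i) + 1) ω) := by
    intro j hj
    obtain ⟨j, rfl⟩ := Nat.exists_eq_add_of_le' hj
    ext ω i
    · simp [block]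
    · simp only [block]
      congr 1
      simp only [Nat.add_sub_cancel]
      have : j + 2 - 1 = j + 1 := rfl
      rw [this]; ring
  rw [hblock j hj, key, ← key ((2 - 2) * m), ← hblock 2 le_rfl]

lemma map_block_two (hY : H.IsObservation θ₀ P Y) (hθ₀ : θ₀ ∈ Θ) (m : ℕ) :
    P.map (block Y m 2) = P.map (block Y m 1) := by
  have h1 := hY.map_shift hθ₀ m m
  have h2 : block Y m 2 = fun ω (i : Fin m) => Y (m + i + 1) ω := by
    ext ω i; simp [block]
  have h3 : block Y m 1 = fun ω (i : Fin m) => Y (i + 1) ω := by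
    ext ω i; simp [block]
  rw [h2, h3, h1]

end StationaryBlocks

/-! ### A measurable majorant of the total variation distance -/

section ErrorBound

variable {d : ℕ}

/-- The density of `N(0, I₀⁻¹)` up to normalization. -/
noncomputable def gaussianKernel (I₀ : Matrix (Fin d) (Fin d) ℝ) (h : Par d) : ℝ :=
  Real.exp (-(1 / 2) * (h.ofLp ⬝ᵥ I₀.mulVec h.ofLp))

lemma measurable_gaussianKernel (I₀ : Matrix (Fin d) (Fin d) ℝ) :
    Measurable (gaussianKernel I₀) := by
  unfold gaussianKernel
  simp only [dotProduct, Matrix.mulVec]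
  fun_prop

lemma multivariateGaussian_eq_normalizeMeasure_gaussianKernel {I₀ : Matrix (Fin d) (Fin d) ℝ}
    (hI₀ : I₀.PosDef) :
    multivariateGaussian 0 I₀⁻¹ =
      normalizeMeasure (volume.withDensity fun h => ENNReal.ofReal (gaussianKernel I₀ h)) :=
  multivariateGaussian_zero_inv_eq_normalizeMeasure hI₀

lemma lintegral_gaussianKernel_ne {I₀ : Matrix (Fin d) (Fin d) ℝ} (hI₀ : I₀.PosDef) :
    ∫⁻ h, ENNReal.ofReal (gaussianKernel I₀ h) ≠ 0 ∧
      ∫⁻ h, ENNReal.ofReal (gaussianKernel I₀ h) ≠ ⊤ := by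
  have h1 : (multivariateGaussian 0 I₀⁻¹ : Measure (Par d)) Set.univ = 1 := measure_univ
  rw [multivariateGaussian_eq_normalizeMeasure_gaussianKernel hI₀, normalizeMeasure,
    Measure.smul_apply, smul_eq_mul, withDensity_apply _ MeasurableSet.univ,
    Measure.restrict_univ] at h1
  constructor
  · intro h0
    rw [h0, mul_zero] at h1
    exact zero_ne_one h1
  · intro ht
    rw [ht, ENNReal.inv_top, zero_mul] at h1
    exact zero_ne_one h1

lemma integrable_gaussianKernel {I₀ : Matrix (Fin d) (Fin d) ℝ} (hI₀ : I₀.PosDef) :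
    Integrable (gaussianKernel I₀) := by
  refine ⟨(measurable_gaussianKernel I₀).aestronglyMeasurable, ?_⟩
  rw [hasFiniteIntegral_iff_ofReal (ae_of_all _ fun h => (Real.exp_pos _).le : 0 ≤ᵐ[volume] gaussianKernel I₀)]
  exact (lintegral_gaussianKernel_ne hI₀).2.lt_top

/-- The `L¹` distance between the unnormalized local posterior density and the Gaussian kernel. -/
noncomputable def localError (Θ : Set (Par d)) (ϖ : Par d → ℝ) (θ₀ : Par d)
    (I₀ : Matrix (Fin d) (Fin d) ℝ) (ℓ Q : Par d → ℝ) (m K : ℕ) (c : Par d) : ENNReal :=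
  ∫⁻ h : Par d, ENNReal.ofReal
    |(|ℓ c ^ K| * ϖ θ₀)⁻¹ * localDensity Θ ϖ Q (m * K) c h - gaussianKernel I₀ h|

/-- An upper bound for the total variation distance between the local posterior and its Gaussian
limit. -/
noncomputable def tvBound (Θ : Set (Par d)) (ϖ : Par d → ℝ) (θ₀ : Par d)
    (I₀ : Matrix (Fin d) (Fin d) ℝ) (ℓ Q : Par d → ℝ) (m K : ℕ) (c : Par d) : ℝ :=
  (min (2 * localError Θ ϖ θ₀ I₀ ℓ Q m K c / ∫⁻ h, ENNReal.ofReal (gaussianKernel I₀ h)) 1).toReal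

/-- No relation between `ℓ`, `Q` and `c` is needed, since any nonnegative rescaling is allowed; the
absolute value in the scale secures its sign. Truncation at 1 keeps the majorant finite when the
`L¹` error is infinite. -/
lemma tvDist_localLaw_posterior_le {Θ : Set (Par d)} (hΘ : MeasurableSet Θ) {ϖ ℓ Q : Par d → ℝ}
    (hϖ : Measurable (Θ.indicator ϖ)) (hQ : Measurable Q) {θ₀ : Par d} (hϖ₀ : 0 < ϖ θ₀)
    {I₀ : Matrix (Fin d) (Fin d) ℝ} (hI₀ : I₀.PosDef) {m K : ℕ} (hmK : 0 < m * K) (c : Par d) :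
    tvDist (localLaw (m * K) c (posterior Θ ϖ Q)) (multivariateGaussian 0 I₀⁻¹) ≤
      tvBound Θ ϖ θ₀ I₀ ℓ Q m K c := by
  rw [localLaw_posterior hΘ hϖ hQ hmK,
    multivariateGaussian_eq_normalizeMeasure_gaussianKernel hI₀, tvBound,
    ← ENNReal.ofReal_le_iff_le_toReal (ne_top_of_le_ne_top ENNReal.one_ne_top (min_le_right _ _))]
  refine le_min ?_ ?_
  · exact tvDist_normalizeMeasure_withDensity_le (measurable_localDensity hϖ hQ _ _)
      (measurable_gaussianKernel I₀) (lintegral_gaussianKernel_ne hI₀).1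
      (lintegral_gaussianKernel_ne hI₀).2 (by positivity)
  · simpa using tvDist_normalizeMeasure_le_one _ _

/-- The total variation distance is a supremum over all measurable sets, with no evident
measurability in the data. The majorant is a parameter integral, so it can be used in subsequence
arguments and in transfers of law. -/
lemma measurable_tvBound {X : Type*} [MeasurableSpace X] {Θ : Set (Par d)} {ϖ : Par d → ℝ}
    (hϖ : Measurable (Θ.indicator ϖ)) (θ₀ : Par d) (I₀ : Matrix (Fin d) (Fin d) ℝ)
    {ℓ Q : Par d × X → ℝ} (hℓ : Measurable ℓ) (hQ : Measurable Q) (m K : ℕ) {c : X → Par d}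
    (hc : Measurable c) :
    Measurable fun x => tvBound Θ ϖ θ₀ I₀ (fun θ => ℓ (θ, x)) (fun θ => Q (θ, x)) m K (c x) := by
  unfold tvBound localError localDensity
  refine (Measurable.min (Measurable.div_const (Measurable.const_mul ?_ _) _)
    measurable_const).ennreal_toReal
  refine Measurable.lintegral_prod_right' (f := fun p : X × Par d => ENNReal.ofReal
    |(|ℓ (c p.1, p.1) ^ K| * ϖ θ₀)⁻¹ * (Q (c p.1 + (Real.sqrt ((m * K : ℕ) : ℝ))⁻¹ • p.2, p.1) *
      Θ.indicator ϖ (c p.1 + (Real.sqrt ((m * K : ℕ) : ℝ))⁻¹ • p.2)) - gaussianKernel I₀ p.2|) ?_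
  have hc1 : Measurable fun p : X × Par d => c p.1 := hc.comp measurable_fst
  have hθ : Measurable fun p : X × Par d => c p.1 + (Real.sqrt ((m * K : ℕ) : ℝ))⁻¹ • p.2 := by
    fun_prop
  have h1 : Measurable fun p : X × Par d => ℓ (c p.1, p.1) :=
    hℓ.comp (hc1.prodMk measurable_fst)
  have h2 : Measurable fun p : X × Par d =>
      Q (c p.1 + (Real.sqrt ((m * K : ℕ) : ℝ))⁻¹ • p.2, p.1) := hQ.comp (hθ.prodMk measurable_fst)
  have h3 := hϖ.comp hθ
  have h4 := (measurable_gaussianKernel I₀).comp (measurable_snd : Measurable fun p : X × Par d => p.2)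
  have h5 : Measurable fun p : X × Par d => |ℓ (c p.1, p.1) ^ K| := (h1.pow_const K).abs
  exact ((((h5.mul_const _).inv.mul (h2.mul h3)).sub h4).abs).ennreal_ofReal

lemma tendsto_tvBound {Θ : Set (Par d)} {ϖ : Par d → ℝ} {θ₀ : Par d}
    {I₀ : Matrix (Fin d) (Fin d) ℝ} (hI₀ : I₀.PosDef) {ℓ Q : ℕ → Par d → ℝ} {m K : ℕ → ℕ}
    {c : ℕ → Par d}
    (h : Tendsto (fun k => localError Θ ϖ θ₀ I₀ (ℓ k) (Q k) (m k) (K k) (c k)) atTop (𝓝 0)) :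
    Tendsto (fun k => tvBound Θ ϖ θ₀ I₀ (ℓ k) (Q k) (m k) (K k) (c k)) atTop (𝓝 0) := by
  have h1 : Tendsto (fun k => 2 * localError Θ ϖ θ₀ I₀ (ℓ k) (Q k) (m k) (K k) (c k) /
      ∫⁻ h, ENNReal.ofReal (gaussianKernel I₀ h)) atTop (𝓝 0) := by
    have h2 := ENNReal.Tendsto.div_const (ENNReal.Tendsto.const_mul (a := 2) h
      (Or.inr (by norm_num))) (Or.inr (lintegral_gaussianKernel_ne hI₀).1)
    simpa using h2
  have h3 := (ENNReal.tendsto_toReal (by simp)).comp (h1.min (tendsto_const_nhds (x := 1)))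
  rw [show (min (0 : ENNReal) 1).toReal = 0 by simp] at h3
  exact h3

end ErrorBound

/-! ### Convergence in probability -/

section InProbability

variable {Ω : Type*} [MeasurableSpace Ω] {P : Measure Ω}

/-- Finitely many sequences converging in measure converge almost surely along a common
subsequence. -/
lemma exists_strictMono_forall_tendsto_ae {ι : Type*} (s : Finset ι) {X : ι → ℕ → Ω → ℝ}
    {g : ι → Ω → ℝ} (h : ∀ i, TendstoInMeasure P (X i) atTop (g i)) :
    ∃ φ : ℕ → ℕ, StrictMono φ ∧
      ∀ᵐ ω ∂P, ∀ i ∈ s, Tendsto (fun k => X i (φ k) ω) atTop (𝓝 (g i ω)) := by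
  classical
  induction s using Finset.induction_on with
  | empty => exact ⟨id, strictMono_id, by simp⟩
  | insert a s _ ih =>
    obtain ⟨φ, hφ, hae⟩ := ih
    obtain ⟨ψ, hψ, hae'⟩ := ((h a).comp hφ.tendsto_atTop).exists_seq_tendsto_ae
    refine ⟨φ ∘ ψ, hφ.comp hψ, ?_⟩
    filter_upwards [hae, hae'] with ω h1 h2 i hi
    rcases Finset.mem_insert.1 hi with rfl | hi
    · exact h2
    · exact (h1 i hi).comp hψ.tendsto_atTop

/-- Places failure of the maximum likelihood property among the sequences converging in measure.
Along an almost surely convergent subsequence the indicator is eventually below 1, so failure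
eventually stops. -/
lemma tendstoInMeasure_indicator_of_tendsto_measure {A : ℕ → Set Ω}
    (h : Tendsto (fun m => P (A m)) atTop (𝓝 0)) :
    TendstoInMeasure P (fun m => (A m).indicator fun _ => (1 : ℝ)) atTop fun _ => 0 := by
  intro ε hε
  refine tendsto_of_tendsto_of_tendsto_of_le_of_le tendsto_const_nhds h (fun _ => zero_le)
    fun m => measure_mono fun ω hω => ?_
  by_contra hcon
  simp only [Set.mem_ofPred_eq, Set.indicator_of_notMem hcon, edist_self] at hω
  exact absurd hω (not_le.2 hε)

/-- Convergence in measure of a function of random elements whose laws do not change. -/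
lemma TendstoInMeasure.of_map_eq {X : ℕ → Type*} [∀ m, MeasurableSpace (X m)]
    {F : (m : ℕ) → X m → ℝ} (hF : ∀ m, Measurable (F m)) {U V : (m : ℕ) → Ω → X m}
    (hU : ∀ m, Measurable (U m)) (hV : ∀ m, Measurable (V m))
    (hUV : ∀ᶠ m in atTop, P.map (V m) = P.map (U m)) {a : ℝ}
    (h : TendstoInMeasure P (fun m ω => F m (U m ω)) atTop fun _ => a) :
    TendstoInMeasure P (fun m ω => F m (V m ω)) atTop fun _ => a := by
  intro ε hε
  refine (h ε hε).congr' ?_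
  filter_upwards [hUV] with m hm
  have hs : MeasurableSet {x | ε ≤ edist (F m x) a} :=
    measurableSet_le measurable_const ((hF m).edist measurable_const)
  change P (U m ⁻¹' {x | ε ≤ edist (F m x) a}) = P (V m ⁻¹' {x | ε ≤ edist (F m x) a})
  rw [← Measure.map_apply (hU m) hs, ← Measure.map_apply (hV m) hs, hm]

/-- Monotonicity of outer measure suffices, so `X` need not be measurable. -/
lemma TendstoInMeasure.of_nonneg_of_le {X Z : ℕ → Ω → ℝ}
    (h : TendstoInMeasure P Z atTop fun _ => 0)
    (hXZ : ∀ᶠ m in atTop, ∀ ω, 0 ≤ X m ω ∧ X m ω ≤ Z m ω) :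
    TendstoInMeasure P X atTop fun _ => 0 := by
  intro ε hε
  refine tendsto_of_tendsto_of_tendsto_of_le_of_le' tendsto_const_nhds (h ε hε)
    (Eventually.of_forall fun _ => zero_le) ?_
  filter_upwards [hXZ] with m hm
  refine measure_mono fun ω hω => le_trans (show ε ≤ edist (X m ω) 0 from hω) ?_
  rw [edist_dist, edist_dist, Real.dist_0_eq_abs, Real.dist_0_eq_abs, abs_of_nonneg (hm ω).1,
    abs_of_nonneg ((hm ω).1.trans (hm ω).2)]
  exact ENNReal.ofReal_le_ofReal (hm ω).2

end InProbability


/-! ### Bernstein-von Mises in probability on a fixed block -/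

section Blocks

variable {d S : ℕ} {𝒴 : Type*} [MeasurableSpace 𝒴] {μ : Measure 𝒴} {Θ : Set (Par d)}
  {H : HMMFamily S μ Θ} {θ₀ : Par d} {Ω : Type*} [MeasurableSpace Ω] {P : Measure Ω}
  [IsProbabilityMeasure P] {Y : ℕ → Ω → 𝒴}

lemma exists_ball_subset_interior_nbhd (hθ₀ : θ₀ ∈ interior Θ) {δ : ℝ} (hδ : 0 < δ) :
    ∃ r > 0, Metric.ball θ₀ r ⊆ interior (nbhd Θ θ₀ δ) := by
  refine Metric.mem_nhds_iff.1 (interior_mem_nhds.2 ?_)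
  filter_upwards [mem_interior_iff_mem_nhds.1 hθ₀, Metric.ball_mem_nhds θ₀ hδ] with θ h1 h2
  exact ⟨h1, by simpa [dist_eq_norm] using (Metric.mem_ball.1 h2).le⟩

/-- Bernstein-von Mises on a fixed block, for a quasi-likelihood asymptotically equivalent to the
`K m`-th power of the block likelihood. -/
theorem tendstoInMeasure_tvBound {K : ℕ → ℕ}
    (hK : Tendsto K atTop atTop) {θhat : (m : ℕ) → (Fin m → 𝒴) → Par d} {j : ℕ} (hj : 1 ≤ j)
    (hMLE : Tendsto (fun m => P {ω | ¬ H.IsMLE (block Y m j ω) (θhat m (block Y m j ω))}) atTop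
      (𝓝 0))
    {δ₀ : ℝ} {I₀ : Matrix (Fin d) (Fin d) ℝ} (hI₀ : I₀.PosDef) {ϖ : Par d → ℝ} (hδ₀ : 0 < δ₀)
    (hdiff : ∀ m : ℕ, 1 ≤ m → ∀ z : Fin m → 𝒴, ∀ θ ∈ interior (nbhd Θ θ₀ δ₀),
      ∀ k : ℕ, k < 3 → DifferentiableAt ℝ (iteratedFDeriv ℝ k (H.logLik z)) θ)
    {E : (m : ℕ) → (Fin m → 𝒴) → ℝ}
    (hE : ∀ m : ℕ, 1 ≤ m → ∀ z : Fin m → 𝒴, ∀ θ ∈ interior (nbhd Θ θ₀ δ₀),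
      ∀ l : Fin 3 → Fin d, |partialDeriv 3 l (H.logLik z) θ| ≤ E m z)
    {C : ℝ} (hC : 0 < C)
    (hElim : TendstoInMeasure P (fun (m : ℕ) ω => E m (block Y m j ω) / m) atTop fun _ => C)
    (hLLN : LikelihoodLLN H θ₀ P Y) (hInfo : ObservedInfoLLN H θ₀ P Y δ₀ I₀)
    (hΘ : IsCompact Θ) (hθ₀ : θ₀ ∈ interior Θ) (hprior : PriorCondition Θ ϖ)
    {Q : ℕ → Ω → Par d → ℝ} (hQ : ∀ m ω, Measurable (Q m ω))
    (hmeas : ∀ m, Measurable fun ω => tvBound Θ ϖ θ₀ I₀ (fun θ => H.lik θ (block Y m j ω)) (Q m ω)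
      m (K m) (θhat m (block Y m j ω)))
    {η : ℕ → ℝ} (hη : Tendsto η atTop (𝓝 0))
    (hQℓ : ∀ᵐ ω ∂P, ∀ᶠ m in atTop, ∀ᵐ θ ∂volume.restrict Θ,
      |Q m ω θ - H.lik θ (block Y m j ω) ^ K m| ≤ η m * H.lik θ (block Y m j ω) ^ K m) :
    TendstoInMeasure P (fun m ω => tvBound Θ ϖ θ₀ I₀ (fun θ => H.lik θ (block Y m j ω)) (Q m ω)
      m (K m) (θhat m (block Y m j ω))) atTop fun _ => 0 := by
  rw [exists_seq_tendstoInMeasure_atTop_iff fun m => (hmeas m).aestronglyMeasurable]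
  intro ns hns
  obtain ⟨L, hL, hmax, hunif⟩ := hLLN
  obtain ⟨hinf, c₁, c₂, hc₁, m₀, hcurv⟩ := hInfo
  obtain ⟨r, hr, hball⟩ := exists_ball_subset_interior_nbhd hθ₀ hδ₀
  have hθ₀' := interior_subset hθ₀
  -- One finite index type collects everything known only in probability: the envelope, failure of
  -- the maximum likelihood property, and the entries of the observed information.
  let X : Option (Option (Fin d × Fin d)) → ℕ → Ω → ℝ := fun i m ω => match i with
    | none => E m (block Y m j ω) / m
    | some none => {ω | ¬ H.IsMLE (block Y m j ω) (θhat m (block Y m j ω))}.indicator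
        (fun _ => (1 : ℝ)) ω
    | some (some p) => -(partialDeriv 2 ![p.1, p.2] (H.logLik (block Y m j ω)) θ₀) / m
  let g : Option (Option (Fin d × Fin d)) → Ω → ℝ := fun i _ => match i with
    | none => C
    | some none => 0
    | some (some p) => I₀ p.1 p.2
  have hX : ∀ i, TendstoInMeasure P (X i) atTop (g i) := by
    rintro (_ | _ | ⟨k, l⟩)
    · exact hElim
    · exact tendstoInMeasure_indicator_of_tendsto_measure hMLE
    · exact hinf j hj (fun _ _ => θ₀) (fun _ => measurable_const) (fun _ _ => hθ₀')
        (ae_of_all _ fun _ => tendsto_const_nhds) k l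
  obtain ⟨ψ, hψ, hae⟩ := exists_strictMono_forall_tendsto_ae Finset.univ
    fun i => (hX i).comp hns.tendsto_atTop
  refine ⟨ψ, hψ, ?_⟩
  have hm : Tendsto (fun k => ns (ψ k)) atTop atTop := hns.tendsto_atTop.comp hψ.tendsto_atTop
  filter_upwards [hae, hunif j hj Θ subset_rfl hΘ, hQℓ] with ω hω hLω hQω
  have hElim' : Tendsto (fun k => E (ns (ψ k)) (block Y (ns (ψ k)) j ω) / (ns (ψ k) : ℕ)) atTop
      (𝓝 C) := hω none (Finset.mem_univ _)
  have hmle' := hω (some none) (Finset.mem_univ _)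
  have hinfo' : ∀ k l : Fin d, Tendsto (fun i =>
      -(partialDeriv 2 ![k, l] (H.logLik (block Y (ns (ψ i)) j ω)) θ₀) / (ns (ψ i) : ℕ)) atTop
      (𝓝 (I₀ k l)) := fun k l => hω (some (some (k, l))) (Finset.mem_univ _)
  refine tendsto_tvBound (ℓ := fun k θ => H.lik θ (block Y (ns (ψ k)) j ω))
    (Q := fun k => Q (ns (ψ k)) ω) (m := fun k => ns (ψ k)) (K := fun k => K (ns (ψ k)))
    (c := fun k => θhat (ns (ψ k)) (block Y (ns (ψ k)) j ω)) hI₀ ?_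
  -- Since the envelope divided by `m` tends to `C`, it is eventually below `C + 1`, whence the
  -- choice of `D`.
  refine tendsto_lintegral_localDensity_quasiLik
    (ℓ := fun k θ => H.lik θ (block Y (ns (ψ k)) j ω))
    (Q := fun k => Q (ns (ψ k)) ω) (m := fun k => ns (ψ k)) (K := fun k => K (ns (ψ k)))
    (c := fun k => θhat (ns (ψ k)) (block Y (ns (ψ k)) j ω)) (D := C + 1)
    (η := fun k => η (ns (ψ k))) hΘ hθ₀ hprior.2.1
    (hprior.1 θ₀ hθ₀') (integrable_gaussianKernel hI₀) hL hmax hm (hK.comp hm)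
    (fun k => hQ _ ω) (hm.eventually hLω.1) (fun u hu => hm.eventually (hLω.2 u hu)) ?_ hr
    (by positivity) hc₁ ?_ ?_ ?_ hinfo' (hη.comp hm) (hm.eventually hQω)
  · filter_upwards [hmle'.eventually (gt_mem_nhds zero_lt_one)] with k hk
    have hk' : H.IsMLE (block Y (ns (ψ k)) j ω) (θhat (ns (ψ k)) (block Y (ns (ψ k)) j ω)) := by
      by_contra hcon
      have h1 : X (some none) (ns (ψ k)) ω = 1 := Set.indicator_of_mem (s := {ω |
        ¬ H.IsMLE (block Y (ns (ψ k)) j ω) (θhat (ns (ψ k)) (block Y (ns (ψ k)) j ω))}) hcon _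
      exact absurd hk (by rw [show (X (some none) ∘ ns) (ψ k) ω = 1 from h1]; norm_num)
    exact hk'
  · filter_upwards [hm.eventually_ge_atTop 1] with k hk θ hθ i hi
    exact hdiff _ hk _ θ (hball hθ) i hi
  · filter_upwards [hm.eventually_ge_atTop 1, hElim'.eventually (gt_mem_nhds (lt_add_one C))]
      with k hk hEk θ hθ l
    have hk' : (0 : ℝ) < (ns (ψ k) : ℕ) := by exact_mod_cast hk
    exact (hE _ hk _ θ (hball hθ) l).trans ((div_lt_iff₀ hk').1 hEk).le
  · filter_upwards [hm.eventually_ge_atTop 1, hm.eventually_ge_atTop m₀] with k hk hk₀ θ hθ v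
    exact (hcurv _ hk₀ hk _ θ (hball hθ) v).1

end Blocks

/-! ### Measurability of the majorants in the data -/

namespace HMMFamily

variable {d S : ℕ} {𝒴 : Type*} [MeasurableSpace 𝒴] {μ : Measure 𝒴} {Θ : Set (Par d)}
  (H : HMMFamily S μ Θ)

lemma measurable_lik_left {n : ℕ} (y : Fin n → 𝒴) : Measurable fun θ => H.lik θ y := by
  have h := H.measurable_lik.comp (measurable_prodMk_right (y := y) (α := Par d))
  exact h

lemma measurable_condLik_left {n n' : ℕ} (y : Fin n → 𝒴) (y' : Fin n' → 𝒴) :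
    Measurable fun θ => H.condLik θ y y' := by
  have h := H.measurable_condLik.comp (measurable_prodMk_right (y := (y, y')) (α := Par d))
  exact h

lemma measurable_tvBound_lik {ϖ : Par d → ℝ} (hϖ : Measurable (Θ.indicator ϖ)) (θ₀ : Par d)
    (I₀ : Matrix (Fin d) (Fin d) ℝ) (m K : ℕ) {θhat : (Fin m → 𝒴) → Par d}
    (hθhat : Measurable θhat) :
    Measurable fun z : Fin m → 𝒴 => tvBound Θ ϖ θ₀ I₀ (fun θ => H.lik θ z)
      (fun θ => H.lik θ z ^ K) m K (θhat z) := by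
  have h1 : Measurable fun p : Par d × (Fin m → 𝒴) => H.lik p.1 p.2 := H.measurable_lik
  have h2 : Measurable fun p : Par d × (Fin m → 𝒴) => H.lik p.1 p.2 ^ K := h1.pow_const K
  exact measurable_tvBound hϖ θ₀ I₀ h1 h2 m K hθhat

lemma measurable_tvBound_condLik {ϖ : Par d → ℝ} (hϖ : Measurable (Θ.indicator ϖ)) (θ₀ : Par d)
    (I₀ : Matrix (Fin d) (Fin d) ℝ) (m K : ℕ) {θhat : (Fin m → 𝒴) → Par d}
    (hθhat : Measurable θhat) :
    Measurable fun z : (Fin m → 𝒴) × (Fin m → 𝒴) => tvBound Θ ϖ θ₀ I₀ (fun θ => H.lik θ z.2)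
      (fun θ => H.condLik θ z.2 z.1 ^ K) m K (θhat z.2) := by
  have h0 : Measurable fun p : Par d × (Fin m → 𝒴) => H.lik p.1 p.2 := H.measurable_lik
  have hs : Measurable fun p : Par d × (Fin m → 𝒴) × (Fin m → 𝒴) => (p.1, p.2.2) := by fun_prop
  have ht : Measurable fun p : Par d × (Fin m → 𝒴) × (Fin m → 𝒴) => (p.1, p.2.2, p.2.1) := by
    fun_prop
  have h1 := h0.comp hs
  have h2 := (H.measurable_condLik (n := m) (n' := m)).comp ht
  have h3 := h2.pow_const K
  exact measurable_tvBound hϖ θ₀ I₀ h1 h3 m K (hθhat.comp measurable_snd)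

end HMMFamily

/-! ### The main theorem -/

theorem theorem1 {d S : ℕ} {𝒴 : Type*} [MeasurableSpace 𝒴] (μ : Measure 𝒴) [SigmaFinite μ]
    (Θ : Set (Par d)) (H : HMMFamily S μ Θ)
    {Ω : Type*} [MeasurableSpace Ω] (P : Measure Ω) [IsProbabilityMeasure P]
    (Y : ℕ → Ω → 𝒴) (θ₀ : Par d) (hY : H.IsObservation θ₀ P Y)
    -- number of subsets
    (K : ℕ → ℕ) (hK : Tendsto K atTop atTop)
    -- maximum likelihood estimators on the blocks
    (θhat : (m : ℕ) → (Fin m → 𝒴) → Par d) (hθhat : ∀ m, Measurable (θhat m))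
    (hMLE : ∀ j : ℕ, 1 ≤ j →
      Tendsto (fun m => P {ω | ¬ H.IsMLE (block Y m j ω) (θhat m (block Y m j ω))}) atTop (𝓝 0))
    -- regularity assumptions
    (δ₀ : ℝ) (I₀ : Matrix (Fin d) (Fin d) ℝ) (hI₀ : I₀.PosDef) (ϖ : Par d → ℝ)
    (hEnvelope : EnvelopeCondition H θ₀ P Y δ₀)
    (hLLN : LikelihoodLLN H θ₀ P Y)
    (hCLT : ScoreCLT H θ₀ P Y I₀)
    (hInfo : ObservedInfoLLN H θ₀ P Y δ₀ I₀)
    (hΘ : IsCompact Θ) (hθ₀ : θ₀ ∈ interior Θ)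
    (hprior : PriorCondition Θ ϖ)
    (hergodic : ∀ θ ∈ Θ, (H.trans θ).IsPrimitive) :
    -- first subset
    TendstoInMeasure P
      (fun m ω => tvDist
        (subsetLocalPosterior H Y ϖ m (K m) 1 (θhat m (block Y m 1 ω)) ω)
        (multivariateGaussian 0 I₀⁻¹))
      atTop (fun _ => (0 : ℝ)) ∧
    -- all later subsets, for every choice of subset indices `2 ≤ j m ≤ K m`
    (∀ M : ℝ, 0 < minTrans H → FilterMixing H θ₀ P Y M →
      (fun m => (K m : ℝ)) =o[atTop] (fun m : ℕ => (mixCoef H M ^ m)⁻¹) →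
      ∀ j : ℕ → ℕ, (∀ᶠ m in atTop, 2 ≤ j m ∧ j m ≤ K m) →
        TendstoInMeasure P
          (fun m ω => tvDist
            (subsetLocalPosterior H Y ϖ m (K m) (j m) (θhat m (block Y m (j m) ω)) ω)
            (multivariateGaussian 0 I₀⁻¹))
          atTop (fun _ => (0 : ℝ))) := by
  obtain ⟨hδ₀, hdiff, E, hEm, hE, C, hC, hElim⟩ := hEnvelope
  have hθ₀' := interior_subset hθ₀
  have hϖm := measurable_indicator_of_continuousOn hΘ hprior.2.1
  have hϖ₀ := hprior.1 θ₀ hθ₀'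
  have hbm := fun m j => measurable_block hY.1 m j
  have hdiff' : ∀ m : ℕ, 1 ≤ m → ∀ z : Fin m → 𝒴, ∀ θ ∈ interior (nbhd Θ θ₀ δ₀),
      ∀ k : ℕ, k < 3 → DifferentiableAt ℝ (iteratedFDeriv ℝ k (H.logLik z)) θ :=
    fun m hm z θ hθ => (hdiff m hm z θ hθ).2
  have hE' : ∀ m : ℕ, 1 ≤ m → ∀ z : Fin m → 𝒴, ∀ θ ∈ interior (nbhd Θ θ₀ δ₀),
      ∀ l : Fin 3 → Fin d, |partialDeriv 3 l (H.logLik z) θ| ≤ E m z :=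
    fun m hm z θ hθ l => hE m hm z θ hθ 3 (by simp) l
  have hE₁ : TendstoInMeasure P (fun (m : ℕ) ω => E m (block Y m 1 ω) / m) atTop fun _ => C :=
    tendstoInMeasure_of_tendsto_ae
      (fun m => (((hEm m).comp (hbm m 1)).div_const _).aestronglyMeasurable) hElim
  -- The envelope is controlled on block 1 only. Equality of laws carries this to block 2, in
  -- probability, which is all that is needed.
  have hE₂ : TendstoInMeasure P (fun (m : ℕ) ω => E m (block Y m 2 ω) / m) atTop fun _ => C :=
    TendstoInMeasure.of_map_eq (F := fun m z => E m z / m) (fun m => (hEm m).div_const _)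
      (fun m => hbm m 1) (fun m => hbm m 2)
      (Eventually.of_forall fun m => map_block_two hY hθ₀' m) hE₁
  have hmK : ∀ᶠ m in atTop, 0 < m * K m := by
    filter_upwards [eventually_gt_atTop 0, hK.eventually_gt_atTop 0] with m h1 h2
    exact Nat.mul_pos h1 h2
  refine ⟨?_, fun M hε hM hKρ j hj => ?_⟩
  · have hQ : ∀ m ω, Measurable fun θ => H.lik θ (block Y m 1 ω) ^ K m :=
      fun m ω => (H.measurable_lik_left _).pow_const _
    have hcore := tendstoInMeasure_tvBound hK le_rfl (hMLE 1 le_rfl) hI₀ hδ₀ hdiff' hE' hC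
      hE₁ hLLN hInfo hΘ hθ₀ hprior hQ
      (fun m => (H.measurable_tvBound_lik hϖm θ₀ I₀ m (K m) (hθhat m)).comp (hbm m 1))
      (tendsto_const_nhds (x := (0 : ℝ)))
      (ae_of_all _ fun ω => Eventually.of_forall fun m => ae_of_all _ fun θ => by simp)
    refine TendstoInMeasure.of_nonneg_of_le hcore ?_
    filter_upwards [hmK] with m hm ω
    have hq : quasiLik H Y m (K m) 1 ω = fun θ => H.lik θ (block Y m 1 ω) ^ K m := by
      ext θ
      rw [quasiLik, if_pos rfl]
    refine ⟨tvDist_nonneg _ _, ?_⟩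
    rw [subsetLocalPosterior, hq]
    exact tvDist_localLaw_posterior_le hΘ.isClosed.measurableSet hϖm (hQ m ω) hϖ₀ hI₀ hm _
  · have hQ : ∀ m j ω, Measurable fun θ =>
        H.condLik θ (block Y m j ω) (block Y m (j - 1) ω) ^ K m := fun m j ω =>
      (H.measurable_condLik_left _ _).pow_const _
    have hF : ∀ m, Measurable fun z : (Fin m → 𝒴) × (Fin m → 𝒴) =>
        tvBound Θ ϖ θ₀ I₀ (fun θ => H.lik θ z.2) (fun θ => H.condLik θ z.2 z.1 ^ K m) m (K m)
          (θhat m z.2) := fun m =>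
      H.measurable_tvBound_condLik hϖm θ₀ I₀ m (K m) (hθhat m)
    have hpair : ∀ m j, Measurable fun ω => (block Y m (j - 1) ω, block Y m j ω) := fun m j =>
      (hbm m (j - 1)).prodMk (hbm m j)
    have hF₂ : ∀ m, Measurable fun ω => tvBound Θ ϖ θ₀ I₀ (fun θ => H.lik θ (block Y m 2 ω))
        (fun θ => H.condLik θ (block Y m 2 ω) (block Y m 1 ω) ^ K m) m (K m)
        (θhat m (block Y m 2 ω)) := by
      intro m
      have h := (hF m).comp (hpair m 2)
      exact h
    have hcore := tendstoInMeasure_tvBound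
      (Q := fun m ω θ => H.condLik θ (block Y m 2 ω) (block Y m 1 ω) ^ K m) hK one_le_two (hMLE 2 one_le_two) hI₀ hδ₀ hdiff'
      hE' hC hE₂ hLLN hInfo hΘ hθ₀ hprior (fun m ω => hQ m 2 ω)
      hF₂ (tendsto_mixing_error H hKρ hε)
      (hM.ae_condLik_pow_close hΘ.isClosed.measurableSet hY.1 hε K)
    -- The majorant is one measurable function of a pair of consecutive blocks, so the result for
    -- `(1, 2)` holds for `(j m - 1, j m)`.
    have hcore' := TendstoInMeasure.of_map_eq hF (fun m => hpair m 2) (fun m => hpair m (j m))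
      (hj.mono fun m hm => map_block_pair hY hθ₀' m hm.1) hcore
    refine TendstoInMeasure.of_nonneg_of_le hcore' ?_
    filter_upwards [hmK, hj] with m hm hjm ω
    have hq : quasiLik H Y m (K m) (j m) ω =
        fun θ => H.condLik θ (block Y m (j m) ω) (block Y m (j m - 1) ω) ^ K m := by
      ext θ
      rw [quasiLik, if_neg (by omega)]
    refine ⟨tvDist_nonneg _ _, ?_⟩
    rw [subsetLocalPosterior, hq]
    exact tvDist_localLaw_posterior_le hΘ.isClosed.measurableSet hϖm (hQ m (j m) ω) hϖ₀ hI₀ hm _
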